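/- Let $\Phi:\mathbb{C}[x]\to[0,\infty)$ be a multiplicative distance function, that is, $\Phi$ is continuous in the coefficients on every finite dimensional subspace of $\mathbb{C}[x]$, and for all $f,g\in\mathbb{C}[x]$ and $w\in\mathbb{C}$: $\Phi(f)=0$ if and only if $f=0$; $\Phi(wf)=|w|\Phi(f)$; and $\Phi(fg)=\Phi(f)\Phi(g)$. Let $\phi(\gamma)=\Phi(x-\gamma)$, $\gamma\in\mathbb{C}$, be its root function. Let $N\ge 0$ be an integer, let $s\in\mathbb{C}$ with $\operatorname{Re}(s)>N$, let $J=\lfloor (N+1)/2\rfloor$, and let $\mathbf{P}=\{P_1,\dots,P_N\}\subset\mathbb{C}[\gamma]$ be any complete family of monic polynomials, i.e. $P_n$ is monic of degree $n-1$ for $n=1,\dots,N$. Put $$F_N(\Phi;s)=\int_{\mathbb{R}^N}\widetilde\Phi(\mathbf b)^{-s}\,d\lambda_N(\mathbf b),\qquad \widetilde\Phi(\mathbf b)=\Phi\Big(x^N+\sum_{n=1}^N b_n x^{N-n}\Big),$$ and, for polynomials $P,Q$, put $\langle P,Q\rangle=\langle P,Q\rangle_{\mathbb R}+\langle P,Q\rangle_{\mathbb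 C}$ with $$\langle P,Q\rangle_{\mathbb R}=\int_{\mathbb{R}^2}\phi(x)^{-s}\phi(y)^{-s}P(x)Q(y)\,\mathrm{sgn}(y-x)\,dx\,dy,$$ $$\langle P,Q\rangle_{\mathbb C}=-2i\int_{\mathbb{C}}\phi(\beta)^{-s}\phi(\overline\beta)^{-s}P(\overline\beta)Q(\beta)\,\mathrm{sgn}(\operatorname{Im}\beta)\,d\lambda_2(\beta),$$ where $\lambda_N$ and $\lambda_2$ are Lebesgue measure on $\mathbb{R}^N$ and on $\mathbb{C}$. Let $U_{\mathbf P}$ be the $2J\times 2J$ matrix with entries $$U_{\mathbf P}[j,k]=\begin{cases}\langle P_j,P_k\rangle & \text{if } j,k\le N,\\ \mathrm{sgn}(k-j)\int_{\mathbb R}\phi(x)^{-s}P_{\min\{j,k\}}(x)\,dx & \text{otherwise,}\end{cases}$$ where for $N$ odd the entry $U_{\mathbf P}[N+1,N+1]$ is $0$. Then the integral defining $F_N(\Phi;s)$ and the integrals $\langle P_j,P_k\rangle_{\mathbb R}$, $\langle P_j,P_k\rangle_{\mathbb C}$ and $\int_{\mathbb R}\phi(x)^{-s}P_j(x)\,dx$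 $(1\le j,k\le N)$ converge absolutely, $U_{\mathbf P}$ is antisymmetric, and $$F_N(\Phi;s)=\operatorname{Pf}U_{\mathbf P},\qquad\text{where}\quad \operatorname{Pf}U=\frac{1}{2^J J!}\sum_{\tau\in S_{2J}}\mathrm{sgn}(\tau)\prod_{j=1}^J U[\tau(2j-1),\tau(2j)].$$ -/

import Mathlib

open MeasureTheory Polynomial

noncomputable section

/-- A multiplicative distance function `Φ : ℂ[x] → [0, ∞)`: continuous in the coefficient vector on
the space of polynomials of degree `< d` for every `d` (every finite dimensional subspace of `ℂ[x]`
lies in one of these), positive definite, absolutely homogeneous and multiplicative. -/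
structure IsMultiplicativeDistance (Φ : ℂ[X] → ℝ) : Prop where
  nonneg : ∀ f, 0 ≤ Φ f
  continuous_coeff : ∀ d : ℕ, Continuous fun c : Fin d → ℂ => Φ (∑ i, C (c i) * X ^ (i : ℕ))
  eq_zero_iff : ∀ f, Φ f = 0 ↔ f = 0
  map_smul : ∀ (w : ℂ) (f : ℂ[X]), Φ (w • f) = ‖w‖ * Φ f
  map_mul : ∀ f g, Φ (f * g) = Φ f * Φ g

/-- The root function `φ(γ) = Φ(x - γ)`. -/
def rootFunction (Φ : ℂ[X] → ℝ) (γ : ℂ) : ℝ := Φ (X - C γ)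

/-- The degree `N` monic restriction `Φ̃(b) = Φ(x^N + ∑_{n=1}^N b_n x^{N-n})`; the coordinate `b_n`
has the index `n - 1` in `Fin N`. -/
def monicRestriction (Φ : ℂ[X] → ℝ) (N : ℕ) (b : Fin N → ℂ) : ℝ :=
  Φ (X ^ N + ∑ i : Fin N, C (b i) * X ^ (N - ((i : ℕ) + 1)))

/-- The integrand `b ↦ Φ̃(b)^{-s}` of the real moment function. -/
def momentIntegrand (Φ : ℂ[X] → ℝ) (N : ℕ) (s : ℂ) (b : Fin N → ℝ) : ℂ :=
  (monicRestriction Φ N (fun i => (b i : ℂ)) : ℂ) ^ (-s)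

/-- The real degree `N` moment function `F_N(Φ; s) = ∫_{ℝ^N} Φ̃(b)^{-s} db`. -/
def realMoment (Φ : ℂ[X] → ℝ) (N : ℕ) (s : ℂ) : ℂ :=
  ∫ b : Fin N → ℝ, momentIntegrand Φ N s b

/-- `φ(γ)^{-s}`. -/
def rootWeight (Φ : ℂ[X] → ℝ) (s γ : ℂ) : ℂ := (rootFunction Φ γ : ℂ) ^ (-s)

/-- The integrand of `⟨P, Q⟩_ℝ`. -/
def realFormIntegrand (Φ : ℂ[X] → ℝ) (s : ℂ) (P Q : ℂ[X]) (z : ℝ × ℝ) : ℂ :=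
  rootWeight Φ s z.1 * rootWeight Φ s z.2 * P.eval (z.1 : ℂ) * Q.eval (z.2 : ℂ) *
    (Real.sign (z.2 - z.1) : ℂ)

/-- `⟨P, Q⟩_ℝ = ∫_{ℝ²} φ(x)^{-s} φ(y)^{-s} P(x) Q(y) sgn(y - x) dx dy`. -/
def realForm (Φ : ℂ[X] → ℝ) (s : ℂ) (P Q : ℂ[X]) : ℂ :=
  ∫ z : ℝ × ℝ, realFormIntegrand Φ s P Q z

/-- The integrand of `⟨P, Q⟩_ℂ`, without the factor `-2i`. -/
def complexFormIntegrand (Φ : ℂ[X] → ℝ) (s : ℂ) (P Q : ℂ[X]) (β : ℂ) : ℂ :=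
  rootWeight Φ s β * rootWeight Φ s (starRingEnd ℂ β) * P.eval (starRingEnd ℂ β) * Q.eval β *
    (Real.sign β.im : ℂ)

/-- `⟨P, Q⟩_ℂ = -2i ∫_ℂ φ(β)^{-s} φ(β̄)^{-s} P(β̄) Q(β) sgn(Im β) dλ₂(β)`. -/
def complexForm (Φ : ℂ[X] → ℝ) (s : ℂ) (P Q : ℂ[X]) : ℂ :=
  -2 * Complex.I * ∫ β : ℂ, complexFormIntegrand Φ s P Q β

/-- `⟨P, Q⟩ = ⟨P, Q⟩_ℝ + ⟨P, Q⟩_ℂ`. -/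
def skewForm (Φ : ℂ[X] → ℝ) (s : ℂ) (P Q : ℂ[X]) : ℂ :=
  realForm Φ s P Q + complexForm Φ s P Q

/-- The integrand of the border entry `∫_ℝ φ(x)^{-s} P(x) dx`. -/
def borderIntegrand (Φ : ℂ[X] → ℝ) (s : ℂ) (P : ℂ[X]) (x : ℝ) : ℂ :=
  rootWeight Φ s x * P.eval (x : ℂ)

/-- A complete family of monic polynomials: `P_1, …, P_N` monic with `deg P_n = n - 1`; `P_n` has
the index `n - 1` in `Fin N`. -/
def IsCompleteMonicFamily {N : ℕ} (P : Fin N → ℂ[X]) : Prop :=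
  ∀ j, (P j).Monic ∧ (P j).natDegree = (j : ℕ)

/-- The `2J × 2J` matrix `U_P`, where `J` is the integer part of `(N + 1) / 2`, with indices from
`0`. Its entries are `⟨P_j, P_k⟩` where both polynomials exist and
`sgn(k - j) ∫_ℝ φ(x)^{-s} P_{min(j,k)}(x) dx` otherwise. The last branch is the corner `j = k = N`
for odd `N`: there `P_{min(j,k)}` does not exist and `sgn(k - j) = 0`. -/
def skewMatrix (Φ : ℂ[X] → ℝ) (s : ℂ) {N : ℕ} (P : Fin N → ℂ[X]) :
    Matrix (Fin (2 * ((N + 1) / 2))) (Fin (2 * ((N + 1) / 2))) ℂ :=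
  Matrix.of fun j k =>
    if h : (j : ℕ) < N ∧ (k : ℕ) < N then
      skewForm Φ s (P ⟨j, h.1⟩) (P ⟨k, h.2⟩)
    else if h' : min (j : ℕ) (k : ℕ) < N then
      ((SignType.sign ((k : ℤ) - (j : ℤ)) : ℤ) : ℂ) *
        ∫ x : ℝ, borderIntegrand Φ s (P ⟨min (j : ℕ) (k : ℕ), h'⟩) x
    else 0

/-- The Pfaffian of a `2J × 2J` (antisymmetric) matrix,
`(1 / (2^J J!)) ∑_{τ ∈ S_{2J}} sgn(τ) ∏_{j=1}^J U[τ(2j-1), τ(2j)]`. -/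
def pfaffian {J : ℕ} (U : Matrix (Fin (2 * J)) (Fin (2 * J)) ℂ) : ℂ :=
  1 / (2 ^ J * (J.factorial : ℂ)) *
    ∑ τ : Equiv.Perm (Fin (2 * J)), ((Equiv.Perm.sign τ : ℤ) : ℂ) *
      ∏ j : Fin J, U (τ ⟨2 * (j : ℕ), by omega⟩) (τ ⟨2 * (j : ℕ) + 1, by omega⟩)

end

/-! The space of real monic polynomials is not split by the number of real roots. One real quadratic
factor `q` is peeled off at a time, with a signed count that treats all signatures alike.

Consider `(q, g) ↦ q * g` with `g` monic of degree `n` and `q` given either by two real roots `x, y`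
or by a conjugate pair `u ± iv`. Its derivative is a Sylvester matrix, so the Jacobians are `|y - x|
|g(x) g(y)|` and `4 |v| |g(u + iv)|²`. Drop the absolute value on `g(x) g(y)`. By the area formula,
a polynomial `f = q g` with simple roots is then counted once for each nonreal root and with the
sign of `-f'(x) f'(y)` for each ordered pair of distinct real roots. The signs of `f'` at the real
roots alternate and end with `+`, so their sum is the parity of `deg f`. It follows that the total
count is the constant `2 ⌊deg f / 2⌋` (`card_sign_pairs`, `integral_signed_paramMulMap`).

The factors `g(x) g(y)` are values of the remaining polynomial at two new points. This leads to
`pointMoment`, the integral of `Φ(f)^{-s} ∏ f(z_i)` over `f` of degree `n`. Since `Φ` and evaluation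
are multiplicative, the count gives a recursion from `(n + 2, m)` to `(n, m + 2)`, where `m` is the
number of points (`pointMoment_add_two`). After multiplication by the Vandermonde product of the
points, the values of `q` at the old points and the difference of the two new points make up the
Vandermonde product of the enlarged set. What is left over is `sgn(y - x)` in the real case and `-2i
sgn(Im β)` in the complex case, the kernels of the two skew forms.

In degree `0` the Vandermonde product is a determinant in the `P_k`. Its Leibniz expansion,
integrated two variables at a time, gives the Pfaffian sum, and the constants `2 ⌊deg f / 2⌋`
multiply to `2^J J!`. For odd `N` a linear factor remains. It gives the border of the matrix, and
`sum_perm_bordered` compares the resulting sum with the Pfaffian of the bordered matrix. -/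

noncomputable section

/-! ### The area formula with multiplicities. -/

open scoped ENNReal NNReal Topology in
/-- The area formula: integrating `|det f'| · g ∘ f` over a set on which `f'` is invertible counts
the points of the fibres of `f`. -/
theorem lintegral_abs_det_mul_comp_eq_lintegral_encard_fiber {E : Type*} [NormedAddCommGroup E]
    [NormedSpace ℝ E] [FiniteDimensional ℝ E] [MeasurableSpace E] [BorelSpace E] (μ : Measure E)
    [μ.IsAddHaarMeasure] {f : E → E} {f' : E → E →L[ℝ] E} {s : Set E} (hs : MeasurableSet s)
    (hf' : ∀ x ∈ s, HasFDerivWithinAt f (f' x) s x) (hdet : ∀ x ∈ s, (f' x).det ≠ 0)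
    {g : E → ℝ≥0∞} (hg : Measurable g) :
    Measurable (fun y => ((s ∩ f ⁻¹' {y}).encard : ℝ≥0∞)) ∧
    ∫⁻ x in s, ENNReal.ofReal |(f' x).det| * g (f x) ∂μ =
      ∫⁻ y, ((s ∩ f ⁻¹' {y}).encard : ℝ≥0∞) * g y ∂μ := by
  classical
  rcases s.eq_empty_or_nonempty with rfl | hne
  · simp
  -- A map that approximates an invertible `A` to within less than `‖A⁻¹‖⁻¹` is injective, hence the
  -- half. The value `1` serves the trivial space, where `‖A⁻¹‖` is `0`, and the singular `A`, which
  -- never occur as the derivative at a point of `s`.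
  let r : (E →L[ℝ] E) → ℝ≥0 := fun A =>
    if h : A.det ≠ 0 then
      (if Subsingleton E then 1
        else ‖((A.toContinuousLinearEquivOfDetNeZero h).symm : E →L[ℝ] E)‖₊⁻¹ / 2)
    else 1
  have hr : ∀ A, r A ≠ 0 := by
    intro A
    simp only [r]
    split_ifs with h1 h2
    · simp
    · rw [not_subsingleton_iff_nontrivial] at h2
      have := (A.toContinuousLinearEquivOfDetNeZero h1).nnnorm_symm_pos
      positivity
    · simp
  obtain ⟨t, A, hdisj, htm, hst, happ, hA⟩ :=
    exists_partition_approximatesLinearOn_of_hasFDerivWithinAt f s f' hf' r hr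
  have hinj : ∀ n, Set.InjOn f (s ∩ t n) := by
    intro n
    obtain ⟨y, hy, hAy⟩ := hA hne n
    have hd : (A n).det ≠ 0 := hAy ▸ hdet y hy
    have h1 := happ n
    rw [← (A n).coe_toContinuousLinearEquivOfDetNeZero hd] at h1
    refine h1.injOn ?_
    rw [(A n).coe_toContinuousLinearEquivOfDetNeZero hd]
    by_cases hE : Subsingleton E
    · exact Or.inl hE
    · right
      simp only [r, hd, hE, dif_pos, if_false, ne_eq, not_false_eq_true]
      rw [not_subsingleton_iff_nontrivial] at hE
      have := ((A n).toContinuousLinearEquivOfDetNeZero hd).nnnorm_symm_pos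
      exact half_lt_self (by positivity)
  have hms : ∀ n, MeasurableSet (s ∩ t n) := fun n => hs.inter (htm n)
  have hder : ∀ n, ∀ x ∈ s ∩ t n, HasFDerivWithinAt f (f' x) (s ∩ t n) x :=
    fun n x hx => (hf' x hx.1).mono Set.inter_subset_left
  have hmi : ∀ n, MeasurableSet (f '' (s ∩ t n)) := fun n =>
    measurable_image_of_fderivWithin (hms n) (hder n) (hinj n)
  have hsU : s = ⋃ n, s ∩ t n := by
    rw [← Set.inter_iUnion]; exact (Set.inter_eq_left.2 hst).symm
  have hdisj' : Pairwise (Function.onFun Disjoint fun n => s ∩ t n) := fun i j hij =>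
    (hdisj hij).mono Set.inter_subset_right Set.inter_subset_right
  -- Each piece `s ∩ t n` contains at most one point of the fibre, so counting points amounts to
  -- counting the pieces whose image contains `y`.
  have hcount : ∀ y, ((s ∩ f ⁻¹' {y}).encard : ℝ≥0∞) =
      ∑' n, (f '' (s ∩ t n)).indicator (fun _ => (1 : ℝ≥0∞)) y := by
    intro y
    rw [← ENNReal.tsum_set_one, tsum_subtype (s ∩ f ⁻¹' {y}) (fun _ => (1 : ℝ≥0∞))]
    have h1 : ∀ x, (s ∩ f ⁻¹' {y}).indicator (fun _ => (1 : ℝ≥0∞)) x =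
        ∑' n, ((s ∩ t n) ∩ f ⁻¹' {y}).indicator (fun _ => (1 : ℝ≥0∞)) x := by
      intro x
      by_cases hx : x ∈ s ∩ f ⁻¹' {y}
      · obtain ⟨n, hn⟩ := Set.mem_iUnion.1 (hst hx.1)
        rw [tsum_eq_single n]
        · rw [Set.indicator_of_mem hx,
            Set.indicator_of_mem (Set.mem_inter (Set.mem_inter hx.1 hn) hx.2)]
        · intro m hm
          refine Set.indicator_of_notMem (fun h => ?_) _
          exact Set.disjoint_left.1 (hdisj hm) h.1.2 hn
      · rw [Set.indicator_of_notMem hx]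
        symm
        rw [ENNReal.tsum_eq_zero]
        intro n
        exact Set.indicator_of_notMem (fun h => hx ⟨h.1.1, h.2⟩) _
    simp_rw [h1]
    rw [ENNReal.tsum_comm]
    refine tsum_congr fun n => ?_
    by_cases hy : y ∈ f '' (s ∩ t n)
    · obtain ⟨x, hx, hxy⟩ := hy
      rw [Set.indicator_of_mem (show y ∈ f '' (s ∩ t n) from ⟨x, hx, hxy⟩), tsum_eq_single x,
        Set.indicator_of_mem (Set.mem_inter hx hxy)]
      intro x' hx'
      refine Set.indicator_of_notMem (fun h => hx' ?_) _
      exact hinj n h.1 hx (h.2.trans hxy.symm)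
    · rw [Set.indicator_of_notMem hy, ENNReal.tsum_eq_zero]
      intro x
      exact Set.indicator_of_notMem (fun h => hy ⟨x, h.1, h.2⟩) _
  simp_rw [hcount]
  refine ⟨Measurable.tsum fun n => measurable_const.indicator (hmi n), ?_⟩
  simp_rw [← ENNReal.tsum_mul_right]
  have hmeas : ∀ n, AEMeasurable
      (fun y => (f '' (s ∩ t n)).indicator (fun _ => (1 : ℝ≥0∞)) y * g y) μ := fun n =>
    ((measurable_const.indicator (hmi n)).mul hg).aemeasurable
  rw [lintegral_tsum hmeas]
  conv_lhs => rw [hsU]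
  rw [lintegral_iUnion hms hdisj']
  refine tsum_congr fun n => ?_
  rw [← lintegral_image_eq_lintegral_abs_det_fderiv_mul μ (hms n) (hder n) (hinj n),
    ← lintegral_indicator (hmi n)]
  refine lintegral_congr fun y => ?_
  by_cases hy : y ∈ f '' (s ∩ t n) <;> simp [hy]

-- As an equality of measures, the area formula passes from nonnegative to complex integrands.
open scoped ENNReal in
theorem map_withDensity_abs_det_eq_withDensity_encard_fiber {E : Type*} [NormedAddCommGroup E]
    [NormedSpace ℝ E] [FiniteDimensional ℝ E] [MeasurableSpace E] [BorelSpace E] (μ : Measure E)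
    [μ.IsAddHaarMeasure] {f : E → E} {f' : E → E →L[ℝ] E} {s : Set E} (hs : MeasurableSet s)
    (hf' : ∀ x, HasFDerivAt f (f' x) x) {J : E → ℝ}
    (hJ : ∀ x, |(f' x).det| = J x) (hne : ∀ x ∈ s, J x ≠ 0) :
    Measurable (fun y => ((s ∩ f ⁻¹' {y}).encard : ℝ≥0∞)) ∧
    ((μ.restrict s).withDensity fun x => ENNReal.ofReal (J x)).map f =
      μ.withDensity fun y => ((s ∩ f ⁻¹' {y}).encard : ℝ≥0∞) := by
  have hdet : ∀ x ∈ s, (f' x).det ≠ 0 := fun x hx h => hne x hx (by rw [← hJ, h, abs_zero])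
  have hfm : Measurable f :=
    (continuous_iff_continuousAt.2 fun x => (hf' x).continuousAt).measurable
  have key := fun (g : E → ℝ≥0∞) (hg : Measurable g) =>
    lintegral_abs_det_mul_comp_eq_lintegral_encard_fiber μ hs
      (fun x _ => (hf' x).hasFDerivWithinAt) hdet hg
  refine ⟨(key 0 measurable_zero).1, ?_⟩
  ext B hB
  have h := (key (B.indicator 1) (measurable_one.indicator hB)).2
  rw [Measure.map_apply hfm hB, withDensity_apply _ (hfm hB), withDensity_apply _ hB,
    ← lintegral_indicator (hfm hB), ← lintegral_indicator hB]
  convert h using 1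
  · refine lintegral_congr fun x => ?_
    by_cases hx : f x ∈ B <;> simp [Set.indicator, hx, hJ]
  · refine lintegral_congr fun x => ?_
    by_cases hx : x ∈ B <;> simp [Set.indicator, hx]

open scoped ENNReal in
/-- The area formula for the Bochner integral, with bounded multiplicity. -/
theorem integral_abs_det_smul_comp_eq_integral_encard_fiber {E : Type*} [NormedAddCommGroup E]
    [NormedSpace ℝ E] [FiniteDimensional ℝ E] [MeasurableSpace E] [BorelSpace E] (μ : Measure E)
    [μ.IsAddHaarMeasure] {f : E → E} {f' : E → E →L[ℝ] E} {s : Set E} (hs : MeasurableSet s)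
    (hf' : ∀ x, HasFDerivAt f (f' x) x) {J : E → ℝ} (hJm : Measurable J)
    (hJ : ∀ x, |(f' x).det| = J x) (hne : ∀ x ∈ s, J x ≠ 0) {K : ℕ}
    (hK : ∀ᵐ y ∂μ, (s ∩ f ⁻¹' {y}).encard ≤ K) {h : E → ℂ} (hh : Integrable h μ) :
    IntegrableOn (fun x => (J x : ℂ) * h (f x)) s μ ∧
    Integrable (fun y => (((s ∩ f ⁻¹' {y}).encard : ℝ≥0∞).toReal : ℂ) * h y) μ ∧
    ∫ x in s, (J x : ℂ) * h (f x) ∂μ =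
      ∫ y, (((s ∩ f ⁻¹' {y}).encard : ℝ≥0∞).toReal : ℂ) * h y ∂μ := by
  obtain ⟨hm, hmap⟩ := map_withDensity_abs_det_eq_withDensity_encard_fiber μ hs hf' hJ hne
  have hfm : Measurable f :=
    (continuous_iff_continuousAt.2 fun x => (hf' x).continuousAt).measurable
  have hJ0 : ∀ x, 0 ≤ J x := fun x => hJ x ▸ abs_nonneg _
  have hK' : ∀ᵐ y ∂μ, ((s ∩ f ⁻¹' {y}).encard : ℝ≥0∞) ≤ K := by
    filter_upwards [hK] with y hy
    exact_mod_cast ENat.toENNReal_le.2 hy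
  have hlt : ∀ᵐ y ∂μ, ((s ∩ f ⁻¹' {y}).encard : ℝ≥0∞) < ∞ := by
    filter_upwards [hK'] with y hy
    exact hy.trans_lt (ENNReal.natCast_lt_top K)
  -- The bound `K` on the multiplicity is needed here; integrability upstairs is then read off from
  -- the equality of measures.
  have hInt : Integrable (fun y => (((s ∩ f ⁻¹' {y}).encard : ℝ≥0∞).toReal : ℂ) * h y) μ := by
    refine hh.bdd_mul (c := K) ?_ ?_
    · exact (Complex.measurable_ofReal.comp hm.ennreal_toReal).aestronglyMeasurable
    · filter_upwards [hK'] with y hy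
      rw [Complex.norm_real, Real.norm_of_nonneg ENNReal.toReal_nonneg]
      exact ENNReal.toReal_le_of_le_ofReal (by positivity) (by simpa using hy)
  have hintM : Integrable h (μ.withDensity fun y => ((s ∩ f ⁻¹' {y}).encard : ℝ≥0∞)) := by
    rw [integrable_withDensity_iff_integrable_smul' hm hlt]
    simpa [Complex.real_smul] using hInt
  have hJm' : Measurable fun x => ENNReal.ofReal (J x) := hJm.ennreal_ofReal
  have hJlt : ∀ᵐ x ∂(μ.restrict s), ENNReal.ofReal (J x) < ∞ :=
    Filter.Eventually.of_forall fun x => ENNReal.ofReal_lt_top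
  have hintM2 := hintM
  rw [← hmap, integrable_map_measure (hmap ▸ hintM.aestronglyMeasurable) hfm.aemeasurable,
    integrable_withDensity_iff_integrable_smul' hJm' hJlt] at hintM2
  refine ⟨?_, hInt, ?_⟩
  · simpa [IntegrableOn, ENNReal.toReal_ofReal (hJ0 _), Complex.real_smul] using hintM2
  · have h1 : ∫ y, h y ∂(μ.withDensity fun y => ((s ∩ f ⁻¹' {y}).encard : ℝ≥0∞)) =
        ∫ y, (((s ∩ f ⁻¹' {y}).encard : ℝ≥0∞).toReal : ℂ) * h y ∂μ := by
      rw [integral_withDensity_eq_integral_toReal_smul hm hlt]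
      simp [Complex.real_smul]
    rw [← h1, ← hmap, integral_map hfm.aemeasurable (hmap ▸ hintM.aestronglyMeasurable),
      integral_withDensity_eq_integral_toReal_smul hJm' hJlt]
    simp [ENNReal.toReal_ofReal (hJ0 _), Complex.real_smul]

/-! ### Monic polynomials and their coefficient vectors. -/

section MonicPoly

variable {R S : Type*} [CommRing R] [CommRing S] {n : ℕ}

/-- The polynomial `∑ bᵢ Xⁱ` of degree less than `n`. -/
def lowPoly (b : Fin n → R) : R[X] := ∑ i, C (b i) * X ^ (i : ℕ)

/-- The monic polynomial `Xⁿ + ∑ bᵢ Xⁱ`. -/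
def monicPoly (b : Fin n → R) : R[X] := X ^ n + lowPoly b

theorem lowPoly_coeff (b : Fin n → R) (k : ℕ) :
    (lowPoly b).coeff k = if h : k < n then b ⟨k, h⟩ else 0 := by
  simp only [lowPoly, finsetSum_coeff, coeff_C_mul, coeff_X_pow, mul_ite, mul_one, mul_zero]
  split_ifs with h
  · rw [Finset.sum_eq_single ⟨k, h⟩]
    · simp
    · intro i _ hi
      rw [if_neg]
      intro hk
      exact hi (Fin.ext hk.symm)
    · simp
  · refine Finset.sum_eq_zero fun i _ => if_neg ?_
    have := i.2
    omega

theorem lowPoly_degree_lt (b : Fin n → R) : (lowPoly b).degree < n := by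
  rw [degree_lt_iff_coeff_zero]
  intro m hm
  rw [lowPoly_coeff, dif_neg (by omega)]

theorem lowPoly_add (b c : Fin n → R) : lowPoly (b + c) = lowPoly b + lowPoly c := by
  simp [lowPoly, add_mul, Finset.sum_add_distrib]

theorem lowPoly_smul (r : R) (b : Fin n → R) : lowPoly (r • b) = r • lowPoly b := by
  simp [lowPoly, smul_eq_C_mul, Finset.mul_sum, mul_assoc]

@[simp] theorem lowPoly_zero : lowPoly (0 : Fin n → R) = 0 := by simp [lowPoly]

theorem lowPoly_single [DecidableEq (Fin n)] (i : Fin n) :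
    lowPoly (Pi.single i (1 : R)) = X ^ (i : ℕ) := by
  rw [lowPoly, Finset.sum_eq_single i] <;> simp +contextual

theorem monicPoly_monic (b : Fin n → R) : (monicPoly b).Monic :=
  monic_X_pow_add (lowPoly_degree_lt b)

theorem monicPoly_natDegree [Nontrivial R] (b : Fin n → R) : (monicPoly b).natDegree = n := by
  apply natDegree_eq_of_degree_eq_some
  rw [monicPoly, degree_add_eq_left_of_degree_lt, degree_X_pow]
  rw [degree_X_pow]
  exact lowPoly_degree_lt b

theorem monicPoly_coeff_fin (b : Fin n → R) (i : Fin n) : (monicPoly b).coeff i = b i := by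
  rw [monicPoly, coeff_add, coeff_X_pow, lowPoly_coeff, if_neg i.2.ne, dif_pos i.2, zero_add]

theorem monicPoly_injective : Function.Injective (monicPoly : (Fin n → R) → R[X]) := by
  intro b c h
  ext i
  rw [← monicPoly_coeff_fin b, h, monicPoly_coeff_fin]

theorem monicPoly_coeff_eq_self {p : R[X]} (hp : p.Monic) (hn : p.natDegree = n) :
    monicPoly (fun i : Fin n => p.coeff i) = p := by
  ext k
  rw [monicPoly, coeff_add, coeff_X_pow, lowPoly_coeff]
  rcases lt_trichotomy k n with h | h | h
  · simp [h, h.ne]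
  · subst h
    simp only [if_true, lt_irrefl, dif_neg, not_false_eq_true, add_zero]
    rw [← hn]; exact hp.symm
  · rw [if_neg h.ne', dif_neg (by omega), coeff_eq_zero_of_natDegree_lt (by omega), add_zero]

theorem monicPoly_map (φ : R →+* S) (b : Fin n → R) :
    (monicPoly b).map φ = monicPoly (fun i => φ (b i)) := by
  simp [monicPoly, lowPoly, Polynomial.map_sum]

end MonicPoly

/-! ### The Jacobian of multiplication by a quadratic factor. -/

section MulMap

variable {n : ℕ}

/-- The first two coordinates of a vector of `2 + n` coordinates. -/
def headTwo (z : Fin (2 + n) → ℝ) : Fin 2 → ℝ := fun i => z (Fin.castAdd n i)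

/-- All but the first two coordinates of a vector of `2 + n` coordinates. -/
def dropTwo (z : Fin (2 + n) → ℝ) : Fin n → ℝ := fun i => z (Fin.natAdd 2 i)

/-- Multiplication of a monic quadratic polynomial with a monic polynomial of degree `n`, in terms
of the coefficients. -/
def mulMap (z : Fin (2 + n) → ℝ) : Fin (2 + n) → ℝ :=
  fun k => (monicPoly (headTwo z) * monicPoly (dropTwo z)).coeff k

theorem monicPoly_mulMap (z : Fin (2 + n) → ℝ) :
    monicPoly (mulMap z) = monicPoly (headTwo z) * monicPoly (dropTwo z) := by
  refine monicPoly_coeff_eq_self ((monicPoly_monic _).mul (monicPoly_monic _)) ?_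
  rw [(monicPoly_monic _).natDegree_mul (monicPoly_monic _), monicPoly_natDegree,
    monicPoly_natDegree]

/-- `lowPoly` as a linear map. -/
def lowPolyLinear (n : ℕ) : (Fin n → ℝ) →ₗ[ℝ] ℝ[X] where
  toFun := lowPoly
  map_add' := lowPoly_add
  map_smul' := lowPoly_smul

/-- The derivative of `mulMap`. -/
def mulMapDeriv (z : Fin (2 + n) → ℝ) : (Fin (2 + n) → ℝ) →ₗ[ℝ] (Fin (2 + n) → ℝ) where
  toFun h k := (lowPoly (headTwo h) * monicPoly (dropTwo z) +
    monicPoly (headTwo z) * lowPoly (dropTwo h)).coeff k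
  map_add' a b := by
    ext k
    have h1 : headTwo (a + b) = headTwo a + headTwo b := rfl
    have h2 : dropTwo (a + b) = dropTwo a + dropTwo b := rfl
    simp only [h1, h2, lowPoly_add, Pi.add_apply, ← coeff_add]
    congr 1
    ring
  map_smul' r a := by
    ext k
    have h1 : headTwo (r • a) = r • headTwo a := rfl
    have h2 : dropTwo (r • a) = r • dropTwo a := rfl
    simp only [h1, h2, lowPoly_smul, Pi.smul_apply, RingHom.id_apply, ← coeff_smul]
    congr 1
    simp [smul_add]

theorem hasFDerivAt_monicPoly_coeff {m : ℕ} (e : Fin n → Fin m) (z : Fin m → ℝ) (j : ℕ) :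
    HasFDerivAt (fun z : Fin m → ℝ => (monicPoly (fun i => z (e i))).coeff j)
      (LinearMap.toContinuousLinearMap
        (lcoeff ℝ j ∘ₗ lowPolyLinear n ∘ₗ LinearMap.funLeft ℝ ℝ e)) z := by
  simp only [monicPoly, coeff_add]
  refine HasFDerivAt.const_add _ ?_
  exact ContinuousLinearMap.hasFDerivAt (LinearMap.toContinuousLinearMap
    (lcoeff ℝ j ∘ₗ lowPolyLinear n ∘ₗ LinearMap.funLeft ℝ ℝ e))

theorem hasFDerivAt_mulMap (z : Fin (2 + n) → ℝ) :
    HasFDerivAt mulMap (LinearMap.toContinuousLinearMap (mulMapDeriv z)) z := by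
  rw [hasFDerivAt_pi']
  intro k
  simp only [mulMap, coeff_mul]
  have key : ∀ x ∈ Finset.HasAntidiagonal.antidiagonal (k : ℕ),
      HasFDerivAt (fun z : Fin (2 + n) → ℝ =>
      (monicPoly (headTwo z)).coeff x.1 * (monicPoly (dropTwo z)).coeff x.2) _ z := fun x _ =>
    (hasFDerivAt_monicPoly_coeff (Fin.castAdd n) z x.1).mul
      (hasFDerivAt_monicPoly_coeff (Fin.natAdd 2) z x.2)
  refine (HasFDerivAt.fun_sum key).congr_fderiv ?_
  ext h
  simp only [mulMapDeriv, sum_apply, add_apply,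
    smul_apply, LinearMap.coe_toContinuousLinearMap', LinearMap.comp_apply,
    ContinuousLinearMap.comp_apply, ContinuousLinearMap.proj_apply, LinearMap.coe_mk,
    AddHom.coe_mk, coeff_add, coeff_mul, lcoeff_apply, smul_eq_mul, ← Finset.sum_add_distrib]
  refine Finset.sum_congr rfl fun x _ => ?_
  simp only [lowPolyLinear, LinearMap.coe_mk, AddHom.coe_mk]
  change (monicPoly (headTwo z)).coeff x.1 * (lowPoly (dropTwo h)).coeff x.2 +
    (monicPoly (dropTwo z)).coeff x.2 * (lowPoly (headTwo h)).coeff x.1 = _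
  ring

/-- With `q` and `g` the two factors, the basis vectors are sent to `X^j g` for `j < 2` and to `X^j
q` for `j < n`; their coefficients are the columns of the Sylvester matrix. -/
theorem toMatrix_mulMapDeriv (z : Fin (2 + n) → ℝ) :
    LinearMap.toMatrix' (mulMapDeriv z) =
      sylvester (monicPoly (headTwo z)) (monicPoly (dropTwo z)) 2 n := by
  ext i j
  rw [LinearMap.toMatrix'_apply]
  have hg : (monicPoly (dropTwo z)).natDegree = n := monicPoly_natDegree _
  have hq : (monicPoly (headTwo z)).natDegree = 2 := monicPoly_natDegree _
  simp only [mulMapDeriv, LinearMap.coe_mk, AddHom.coe_mk]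
  induction j using Fin.addCases with
  | left j =>
    have h1 : headTwo (Pi.single (Fin.castAdd n j) (1 : ℝ)) = Pi.single j 1 := by
      ext k; simp [headTwo, Pi.single_apply]
    have h2 : dropTwo (Pi.single (Fin.castAdd n j) (1 : ℝ)) = 0 := by
      ext k
      simp only [dropTwo, Pi.single_apply, Pi.zero_apply, ite_eq_right_iff, one_ne_zero, imp_false]
      rw [Fin.ext_iff]
      simp; omega
    simp only [h1, h2, lowPoly_single, lowPoly_zero, mul_zero, add_zero, coeff_X_pow_mul',
      sylvester, Matrix.of_apply, Fin.addCases_left, Set.mem_Icc, ite_and]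
    split_ifs with h3 h4
    · rfl
    · exact coeff_eq_zero_of_natDegree_lt (by omega)
    · rfl
  | right j =>
    have h1 : dropTwo (Pi.single (Fin.natAdd 2 j) (1 : ℝ)) = Pi.single j 1 := by
      ext k; simp [dropTwo, Pi.single_apply]
    have h2 : headTwo (Pi.single (Fin.natAdd 2 j) (1 : ℝ)) = 0 := by
      ext k
      simp only [headTwo, Pi.single_apply, Pi.zero_apply, ite_eq_right_iff, one_ne_zero, imp_false]
      rw [Fin.ext_iff]
      simp; omega
    simp only [h1, h2, lowPoly_single, lowPoly_zero, zero_mul, zero_add, coeff_mul_X_pow',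
      sylvester, Matrix.of_apply, Fin.addCases_right, Set.mem_Icc, ite_and]
    split_ifs with h3 h4
    · rfl
    · exact coeff_eq_zero_of_natDegree_lt (by omega)
    · rfl

theorem det_mulMapDeriv (z : Fin (2 + n) → ℝ) :
    LinearMap.det (mulMapDeriv z) =
      resultant (monicPoly (headTwo z)) (monicPoly (dropTwo z)) 2 n := by
  rw [← LinearMap.det_toMatrix', toMatrix_mulMapDeriv]
  rfl

/-- The resultant is multiplicative in its first argument. Working over `ℂ` covers real pairs and
conjugate pairs together. -/
theorem resultant_of_map_eq_mul {q g : ℝ[X]} {α β : ℂ} (hg : g.natDegree ≤ n)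
    (hq : q.map Complex.ofRealHom = (X - C α) * (X - C β)) :
    ((resultant q g 2 n : ℝ) : ℂ) =
      (g.map Complex.ofRealHom).eval α * (g.map Complex.ofRealHom).eval β := by
  have h1 : ((resultant q g 2 n : ℝ) : ℂ) =
      resultant (q.map Complex.ofRealHom) (g.map Complex.ofRealHom) 2 n := by
    rw [resultant_map_map]; rfl
  have hg' : (g.map Complex.ofRealHom).natDegree ≤ n := natDegree_map_le.trans hg
  have h2 := resultant_mul_left (X - C α) (X - C β) (g.map Complex.ofRealHom) n hg'
  simp only [natDegree_X_sub_C] at h2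
  rw [h1, hq, h2, resultant_X_sub_C_left _ _ _ hg', resultant_X_sub_C_left _ _ _ hg']

/-- Multiplication of a monic quadratic polynomial, given in the parametrization `ρ`, with a monic
polynomial of degree `n`. -/
def paramMulMap (ρ : (Fin 2 → ℝ) → Fin 2 → ℝ) (z : Fin (2 + n) → ℝ) : Fin (2 + n) → ℝ :=
  mulMap (Fin.append (ρ (headTwo z)) (dropTwo z))

theorem headTwo_append (a : Fin 2 → ℝ) (b : Fin n → ℝ) : headTwo (Fin.append a b) = a := by
  ext i; simp [headTwo]

theorem dropTwo_append (a : Fin 2 → ℝ) (b : Fin n → ℝ) : dropTwo (Fin.append a b) = b := by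
  ext i; simp [dropTwo]

theorem append_headTwo_dropTwo (z : Fin (2 + n) → ℝ) :
    Fin.append (headTwo z) (dropTwo z) = z := by
  ext i
  induction i using Fin.addCases <;> simp [headTwo, dropTwo]

theorem monicPoly_paramMulMap (ρ : (Fin 2 → ℝ) → Fin 2 → ℝ) (z : Fin (2 + n) → ℝ) :
    monicPoly (paramMulMap ρ z) = monicPoly (ρ (headTwo z)) * monicPoly (dropTwo z) := by
  rw [paramMulMap, monicPoly_mulMap, headTwo_append, dropTwo_append]

/-- The endomorphism of `ℝ^(2+n)` which is `A` on the first two coordinates and the identity on the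
others. -/
def blockMap (n : ℕ) (A : Matrix (Fin 2) (Fin 2) ℝ) :
    (Fin (2 + n) → ℝ) →ₗ[ℝ] (Fin (2 + n) → ℝ) :=
  Matrix.toLin' ((Matrix.fromBlocks A 0 0 1).reindex finSumFinEquiv finSumFinEquiv)

theorem det_blockMap (A : Matrix (Fin 2) (Fin 2) ℝ) : LinearMap.det (blockMap n A) = A.det := by
  rw [blockMap, LinearMap.det_toLin', Matrix.det_reindex_self, Matrix.det_fromBlocks_zero₂₁,
    Matrix.det_one, mul_one]

theorem blockMap_apply (A : Matrix (Fin 2) (Fin 2) ℝ) (z : Fin (2 + n) → ℝ) :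
    blockMap n A z = Fin.append (A.mulVec (headTwo z)) (dropTwo z) := by
  ext i
  rw [blockMap, Matrix.toLin'_apply, Matrix.mulVec, dotProduct, ← finSumFinEquiv.sum_comp,
    Fintype.sum_sum_type]
  induction i using Fin.addCases with
  | left i => fin_cases i <;> simp [headTwo]
  | right i => simp [dropTwo, Matrix.one_apply]

theorem hasFDerivAt_append_headTwo {ρ : (Fin 2 → ℝ) → Fin 2 → ℝ} {A : Matrix (Fin 2) (Fin 2) ℝ}
    {z : Fin (2 + n) → ℝ}
    (hρ : HasFDerivAt ρ (LinearMap.toContinuousLinearMap (Matrix.toLin' A)) (headTwo z)) :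
    HasFDerivAt (fun z => Fin.append (ρ (headTwo z)) (dropTwo z))
      (LinearMap.toContinuousLinearMap (blockMap n A)) z := by
  rw [hasFDerivAt_pi']
  intro k
  have h1 : HasFDerivAt (fun z : Fin (2 + n) → ℝ => headTwo z)
      (LinearMap.toContinuousLinearMap (LinearMap.funLeft ℝ ℝ (Fin.castAdd n))) z :=
    ContinuousLinearMap.hasFDerivAt
      (LinearMap.toContinuousLinearMap (LinearMap.funLeft ℝ ℝ (Fin.castAdd n)))
  have h2 := hρ.comp z h1
  induction k using Fin.addCases with
  | left k =>
    simp only [Fin.append_left]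
    refine ((hasFDerivAt_pi'.1 h2) k).congr_fderiv ?_
    ext h
    simp only [ContinuousLinearMap.comp_apply, ContinuousLinearMap.proj_apply,
      LinearMap.coe_toContinuousLinearMap', blockMap_apply, Fin.append_left, Matrix.toLin'_apply]
    rfl
  | right k =>
    simp only [Fin.append_right]
    refine (hasFDerivAt_apply (𝕜 := ℝ) (Fin.natAdd 2 k) z).congr_fderiv ?_
    ext h
    simp [blockMap_apply, dropTwo]

/-- The derivative of `paramMulMap ρ` where `ρ` has the derivative `A`. -/
def paramMulDeriv (ρ : (Fin 2 → ℝ) → Fin 2 → ℝ) (A : Matrix (Fin 2) (Fin 2) ℝ)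
    (z : Fin (2 + n) → ℝ) : (Fin (2 + n) → ℝ) →L[ℝ] (Fin (2 + n) → ℝ) :=
  LinearMap.toContinuousLinearMap
    (mulMapDeriv (Fin.append (ρ (headTwo z)) (dropTwo z)) ∘ₗ blockMap n A)

theorem hasFDerivAt_paramMulMap {ρ : (Fin 2 → ℝ) → Fin 2 → ℝ} {A : Matrix (Fin 2) (Fin 2) ℝ}
    {z : Fin (2 + n) → ℝ}
    (hρ : HasFDerivAt ρ (LinearMap.toContinuousLinearMap (Matrix.toLin' A)) (headTwo z)) :
    HasFDerivAt (paramMulMap ρ) (paramMulDeriv ρ A z) z := by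
  have h := HasFDerivAt.comp (g := mulMap)
    (f := fun z : Fin (2 + n) → ℝ => Fin.append (ρ (headTwo z)) (dropTwo z)) z
    (hasFDerivAt_mulMap _) (hasFDerivAt_append_headTwo hρ)
  have h2 : paramMulDeriv ρ A z = (LinearMap.toContinuousLinearMap
      (mulMapDeriv (Fin.append (ρ (headTwo z)) (dropTwo z)))).comp
      (LinearMap.toContinuousLinearMap (blockMap n A)) := by
    ext1 v
    simp only [paramMulDeriv, LinearMap.coe_toContinuousLinearMap', ContinuousLinearMap.comp_apply,
      LinearMap.comp_apply]
  rw [h2]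
  exact h

theorem det_paramMulDeriv {ρ : (Fin 2 → ℝ) → Fin 2 → ℝ} {A : Matrix (Fin 2) (Fin 2) ℝ}
    {z : Fin (2 + n) → ℝ} : (paramMulDeriv ρ A z).det =
      resultant (monicPoly (ρ (headTwo z))) (monicPoly (dropTwo z)) 2 n * A.det := by
  rw [paramMulDeriv, LinearMap.det_toContinuousLinearMap, LinearMap.det_comp, det_mulMapDeriv,
    det_blockMap, headTwo_append, dropTwo_append]

end MulMap

/-! ### Quadratic factors by a pair of real roots or by a conjugate pair. -/

section Parametrizations

variable {n : ℕ}

/-- The coefficients of the quadratic polynomial with the two real roots `v 0`, `v 1`. -/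
def realPair (v : Fin 2 → ℝ) : Fin 2 → ℝ := ![v 0 * v 1, -(v 0 + v 1)]

/-- The coefficients of the real quadratic polynomial with the root `v 0 + i v 1`. -/
def conjPair (v : Fin 2 → ℝ) : Fin 2 → ℝ := ![v 0 ^ 2 + v 1 ^ 2, -(2 * v 0)]

theorem monicPoly_realPair (v : Fin 2 → ℝ) :
    monicPoly (realPair v) = (X - C (v 0)) * (X - C (v 1)) := by
  simp only [monicPoly, lowPoly, Fin.sum_univ_two, realPair, Matrix.cons_val_zero,
    Matrix.cons_val_one, Fin.val_zero, Fin.val_one, map_mul, map_neg, map_add]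
  ring

theorem monicPoly_realPair_map (v : Fin 2 → ℝ) :
    (monicPoly (realPair v)).map Complex.ofRealHom =
      (X - C (v 0 : ℂ)) * (X - C (v 1 : ℂ)) := by
  rw [monicPoly_realPair]; simp

/-- The conjugate root stands first, as in `complexFormIntegrand`, where the first polynomial is
evaluated at the conjugate. -/
theorem monicPoly_conjPair_map (v : Fin 2 → ℝ) :
    (monicPoly (conjPair v)).map Complex.ofRealHom =
      (X - C (v 0 - v 1 * Complex.I : ℂ)) * (X - C (v 0 + v 1 * Complex.I : ℂ)) := by
  have h : (C Complex.I : ℂ[X]) ^ 2 = -1 := by rw [← C_pow, Complex.I_sq]; simp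
  simp only [monicPoly, lowPoly, Fin.sum_univ_two, conjPair, Matrix.cons_val_zero,
    Matrix.cons_val_one, Fin.val_zero, Fin.val_one]
  simp only [Polynomial.map_add, Polynomial.map_neg, Polynomial.map_mul, Polynomial.map_pow,
    map_X, map_C, map_add,
    map_sub, map_mul, map_neg, map_pow, Complex.ofRealHom_eq_coe, map_ofNat, Polynomial.map_ofNat]
  linear_combination (C (v 1 : ℂ)) ^ 2 * h

/-- The derivative of `realPair`. -/
def realPairDeriv (v : Fin 2 → ℝ) : Matrix (Fin 2) (Fin 2) ℝ := !![v 1, v 0; -1, -1]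

/-- The derivative of `conjPair`. -/
def conjPairDeriv (v : Fin 2 → ℝ) : Matrix (Fin 2) (Fin 2) ℝ := !![2 * v 0, 2 * v 1; -2, 0]

theorem hasFDerivAt_realPair (v : Fin 2 → ℝ) : HasFDerivAt realPair
    (LinearMap.toContinuousLinearMap (Matrix.toLin' (realPairDeriv v))) v := by
  have h0 := hasFDerivAt_apply (𝕜 := ℝ) (0 : Fin 2) v
  have h1 := hasFDerivAt_apply (𝕜 := ℝ) (1 : Fin 2) v
  rw [hasFDerivAt_pi']
  intro k
  fin_cases k
  · refine (h0.mul h1).congr_fderiv ?_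
    ext h
    simp [realPairDeriv, dotProduct]
    ring
  · refine (h0.add h1).neg.congr_fderiv ?_
    ext h
    simp [realPairDeriv, dotProduct]
    ring

theorem hasFDerivAt_conjPair (v : Fin 2 → ℝ) : HasFDerivAt conjPair
    (LinearMap.toContinuousLinearMap (Matrix.toLin' (conjPairDeriv v))) v := by
  have h0 := hasFDerivAt_apply (𝕜 := ℝ) (0 : Fin 2) v
  have h1 := hasFDerivAt_apply (𝕜 := ℝ) (1 : Fin 2) v
  rw [hasFDerivAt_pi']
  intro k
  fin_cases k
  · refine ((h0.pow 2).add (h1.pow 2)).congr_fderiv ?_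
    ext h
    simp [conjPairDeriv, dotProduct]
  · refine (h0.const_mul 2).neg.congr_fderiv ?_
    ext h
    simp [conjPairDeriv, dotProduct]

/-- The factor `g(x) g(y)` of the Jacobian of `paramMulMap realPair`. -/
def realJac (z : Fin (2 + n) → ℝ) : ℝ :=
  (monicPoly (dropTwo z)).eval (headTwo z 0) * (monicPoly (dropTwo z)).eval (headTwo z 1)

/-- The factor `|g(u + iv)|²` of the Jacobian of `paramMulMap conjPair`. -/
def conjJac (z : Fin (2 + n) → ℝ) : ℝ :=
  ‖((monicPoly (dropTwo z)).map Complex.ofRealHom).eval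
    (headTwo z 0 + headTwo z 1 * Complex.I : ℂ)‖ ^ 2

theorem eval_map_ofReal_conj (g : ℝ[X]) (z : ℂ) :
    (g.map Complex.ofRealHom).eval (starRingEnd ℂ z) =
      starRingEnd ℂ ((g.map Complex.ofRealHom).eval z) := by
  rw [eval_map, eval_map, hom_eval₂]
  congr 1
  ext x
  simp

theorem det_realPair (z : Fin (2 + n) → ℝ) :
    |(paramMulDeriv realPair (realPairDeriv (headTwo z)) z).det| =
      |headTwo z 1 - headTwo z 0| * |realJac z| := by
  have h := resultant_of_map_eq_mul (n := n) (g := monicPoly (dropTwo z))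
    (monicPoly_natDegree _).le (monicPoly_realPair_map (headTwo z))
  have h2 : resultant (monicPoly (realPair (headTwo z))) (monicPoly (dropTwo z)) 2 n =
      realJac z := by
    rw [← Complex.ofReal_inj, h, realJac]
    have h3 : ∀ x : ℝ, ((monicPoly (dropTwo z)).map Complex.ofRealHom).eval (x : ℂ) =
        ((monicPoly (dropTwo z)).eval x : ℝ) := fun x => by
      rw [← Complex.ofRealHom_eq_coe, eval_map_apply]; rfl
    rw [h3, h3, Complex.ofReal_mul]
  rw [det_paramMulDeriv, h2, abs_mul, mul_comm]
  congr 1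
  rw [realPairDeriv, Matrix.det_fin_two_of]
  rw [← abs_neg]; congr 1; ring

theorem det_conjPair (z : Fin (2 + n) → ℝ) :
    |(paramMulDeriv conjPair (conjPairDeriv (headTwo z)) z).det| =
      4 * |headTwo z 1| * conjJac z := by
  have h := resultant_of_map_eq_mul (n := n) (g := monicPoly (dropTwo z))
    (monicPoly_natDegree _).le (monicPoly_conjPair_map (headTwo z))
  have h2 : resultant (monicPoly (conjPair (headTwo z))) (monicPoly (dropTwo z)) 2 n =
      conjJac z := by
    rw [← Complex.ofReal_inj, h, conjJac]
    have h3 : (headTwo z 0 - headTwo z 1 * Complex.I : ℂ) =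
        starRingEnd ℂ (headTwo z 0 + headTwo z 1 * Complex.I : ℂ) := by
      simp [sub_eq_add_neg]
    rw [h3, eval_map_ofReal_conj, Complex.conj_mul', Complex.ofReal_pow]
  have h4 : 0 ≤ conjJac z := sq_nonneg _
  rw [det_paramMulDeriv, h2, abs_mul, abs_of_nonneg h4, mul_comm]
  congr 1
  rw [conjPairDeriv, Matrix.det_fin_two_of]
  rw [show 2 * headTwo z 0 * 0 - 2 * headTwo z 1 * -2 = 4 * headTwo z 1 by ring, abs_mul]
  norm_num

end Parametrizations

/-! ### The signed count of the quadratic factors. -/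

section SignCount

/-- A nonconstant monic polynomial tends to `+∞`, so a negative value at `x₀` would force a zero to
the right of it. -/
theorem Polynomial.Monic.eval_pos_of_forall_ge_ne_zero {p : ℝ[X]} (hp : p.Monic) {x₀ : ℝ}
    (h : ∀ x, x₀ ≤ x → p.eval x ≠ 0) : 0 < p.eval x₀ := by
  by_contra hneg
  have hlt : p.eval x₀ < 0 := lt_of_le_of_ne (not_lt.1 hneg) (h x₀ le_rfl)
  have hdeg : 0 < p.degree := by
    by_contra hd
    rw [not_lt, hp.degree_le_zero_iff_eq_one] at hd
    rw [hd, eval_one] at hlt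
    linarith
  have ht := tendsto_atTop_of_leadingCoeff_nonneg p hdeg
    (by rw [hp.leadingCoeff]; exact zero_le_one)
  obtain ⟨x₁, hx₁, hpos⟩ := ((Filter.eventually_ge_atTop x₀).and
    (ht.eventually_gt_atTop 0)).exists
  have hIVT := intermediate_value_Icc hx₁ p.continuous.continuousOn
  obtain ⟨c, hc, hc0⟩ := hIVT ⟨hlt.le, hpos.le⟩
  exact h c hc.1 hc0

theorem Polynomial.Monic.even_natDegree_of_forall_ne_zero {p : ℝ[X]} (hp : p.Monic)
    (h : ∀ x, p.eval x ≠ 0) : Even p.natDegree := by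
  by_contra hodd
  rw [Nat.not_even_iff_odd] at hodd
  have h1 := hp.eval_pos_of_forall_ge_ne_zero (x₀ := 0) fun x _ => h x
  -- In odd degree `-p(-X)` is also monic without zeros, so `p(0)` and `-p(0)` would both be
  -- positive.
  have hm : (-p.comp (-X)).Monic := by
    rw [Monic, leadingCoeff_neg, leadingCoeff_comp (by simp), hp.leadingCoeff]
    simp [hodd.neg_one_pow]
  have h2 := hm.eval_pos_of_forall_ge_ne_zero (x₀ := 0) fun x _ => by
    simpa [eval_comp] using h (-x)
  simp [eval_comp] at h2
  linarith

/-- Remove the largest root: `p = (X - x₀) g`. Then `p'(x₀) = g(x₀) > 0`, while at every other root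
`p' = (x - x₀) g'` has the sign opposite to `g'`. The sum `S` for `g` thus becomes `1 - S` for `p`,
which flips the parity along with the degree. Without real roots the degree is even. -/
theorem Polynomial.Monic.sum_sign_derivative {p : ℝ[X]} (hp : p.Monic)
    (hsimple : ∀ x, p.eval x = 0 → p.derivative.eval x ≠ 0) :
    ∑ x ∈ p.roots.toFinset, ((SignType.sign (p.derivative.eval x) : SignType) : ℤ) =
      ((p.natDegree % 2 : ℕ) : ℤ) := by
  induction hN : p.natDegree generalizing p with
  | zero =>
    have : p = 1 := by rwa [hp.natDegree_eq_zero] at hN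
    simp [this]
  | succ N ih =>
    by_cases hroot : p.roots.toFinset.Nonempty
    · obtain ⟨x₀, hx₀, hmax⟩ := p.roots.toFinset.exists_max_image id hroot
      have hx₀r : p.IsRoot x₀ := by simpa [hp.ne_zero] using hx₀
      obtain ⟨g, rfl⟩ := dvd_iff_isRoot.2 hx₀r
      have hg : g.Monic := (monic_X_sub_C x₀).of_mul_monic_left hp
      have hder : ∀ x, (derivative ((X - C x₀) * g)).eval x =
          g.eval x + (x - x₀) * g.derivative.eval x := by
        intro x; simp [derivative_mul]
      have hgx₀ : g.eval x₀ ≠ 0 := by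
        intro h0
        refine hsimple x₀ (by simp) ?_
        rw [hder, h0]; simp
      have hmax' : ∀ x, g.eval x = 0 → x < x₀ := by
        intro x hx
        have h1 : x ≤ x₀ := hmax x (by simp [hp.ne_zero, hx])
        exact lt_of_le_of_ne h1 fun h => hgx₀ (h ▸ hx)
      have hpos : 0 < g.eval x₀ := hg.eval_pos_of_forall_ge_ne_zero fun x hx h0 =>
        absurd (hmax' x h0) (not_lt.2 hx)
      have hdeg : g.natDegree = N := by
        rw [(monic_X_sub_C x₀).natDegree_mul hg, natDegree_X_sub_C] at hN
        omega
      have ih' := ih hg (fun x hx h0 => hsimple x (by simp [hx]) (by rw [hder, hx, h0]; simp)) hdeg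
      have hins : ((X - C x₀) * g).roots.toFinset = insert x₀ g.roots.toFinset := by
        rw [roots_mul hp.ne_zero]; ext; simp
      rw [hins, Finset.sum_insert (by simp [hgx₀])]
      have h1 : ∑ x ∈ g.roots.toFinset,
          ((SignType.sign ((derivative ((X - C x₀) * g)).eval x) : SignType) : ℤ) =
          ∑ x ∈ g.roots.toFinset, -((SignType.sign (g.derivative.eval x) : SignType) : ℤ) := by
        refine Finset.sum_congr rfl fun x hx => ?_
        have hx0 : g.eval x = 0 := by simpa [hg.ne_zero] using hx
        rw [hder, hx0, zero_add, sign_mul, sign_neg (sub_neg.2 (hmax' x hx0))]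
        simp
      rw [h1, Finset.sum_neg_distrib, ih', hder, sub_self, zero_mul, add_zero, sign_pos hpos]
      simp only [SignType.coe_one]
      omega
    · have hno : ∀ x, p.eval x ≠ 0 := fun x hx =>
        hroot ⟨x, by simp [hp.ne_zero, hx]⟩
      have := hp.even_natDegree_of_forall_ne_zero hno
      rw [Finset.not_nonempty_iff_eq_empty.1 hroot, Finset.sum_empty]
      rw [hN] at this
      rw [Nat.even_iff.1 this]
      rfl

theorem Polynomial.card_roots_real_add_card_nonreal {p : ℝ[X]} (hp : p.Monic)
    (hsimple : ∀ β : ℂ, (p.map Complex.ofRealHom).eval β = 0 →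
      (p.map Complex.ofRealHom).derivative.eval β ≠ 0) :
    p.roots.toFinset.card +
      ((p.map Complex.ofRealHom).roots.toFinset.filter fun β => β.im ≠ 0).card = p.natDegree := by
  set P := p.map Complex.ofRealHom with hP
  have hP0 : P ≠ 0 := (hp.map _).ne_zero
  have hnd : P.roots.Nodup := by
    rw [Multiset.nodup_iff_count_le_one]
    intro β
    rw [count_roots]
    by_contra hlt
    have h2 := (one_lt_rootMultiplicity_iff_isRoot hP0).1 (not_le.1 hlt)
    exact hsimple β h2.1 h2.2
  have hcard : P.roots.toFinset.card = p.natDegree := by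
    rw [Multiset.toFinset_card_of_nodup hnd, IsAlgClosed.card_roots_eq_natDegree, hP,
      hp.natDegree_map]
  rw [← hcard, ← Finset.card_filter_add_card_filter_not (s := P.roots.toFinset) (fun β => β.im = 0)]
  congr 1
  rw [← Finset.card_map ⟨((↑) : ℝ → ℂ), Complex.ofReal_injective⟩]
  congr 1
  ext β
  simp only [Finset.mem_map, Multiset.mem_toFinset, mem_roots hp.ne_zero, Finset.mem_filter,
    mem_roots hP0, Function.Embedding.coeFn_mk, IsRoot.def]
  constructor
  · rintro ⟨x, hx, rfl⟩
    refine ⟨?_, Complex.ofReal_im x⟩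
    rw [hP, ← Complex.ofRealHom_eq_coe, eval_map_apply, hx, map_zero]
  · rintro ⟨h1, h2⟩
    obtain ⟨x, rfl⟩ : ∃ x : ℝ, (x : ℂ) = β := ⟨β.re, Complex.ext (by simp) (by simp [h2])⟩
    refine ⟨x, ?_, rfl⟩
    rw [hP, ← Complex.ofRealHom_eq_coe, eval_map_apply] at h1
    simpa using h1

/-- Let `d` be the degree, `r` the number of real roots and `ε` the sign of `p'` at a real root. The
sum of `ε(x) ε(y)` over `x ≠ y` is `(∑ ε)² - r = d % 2 - r`, because `∑ ε = d % 2` is its own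
square. So negative pairs exceed positive pairs by `r - d % 2`; adding the `d - r` nonreal roots
eliminates `r` and leaves `d - d % 2`. -/
theorem Polynomial.card_sign_pairs {p : ℝ[X]} (hp : p.Monic)
    (hsimple : ∀ β : ℂ, (p.map Complex.ofRealHom).eval β = 0 →
      (p.map Complex.ofRealHom).derivative.eval β ≠ 0) :
    (p.roots.toFinset.offDiag.filter fun v =>
        p.derivative.eval v.1 * p.derivative.eval v.2 < 0).card +
      ((p.map Complex.ofRealHom).roots.toFinset.filter fun β => β.im ≠ 0).card =
    (p.roots.toFinset.offDiag.filter fun v =>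
        0 < p.derivative.eval v.1 * p.derivative.eval v.2).card + 2 * (p.natDegree / 2) := by
  have hs : ∀ x, p.eval x = 0 → p.derivative.eval x ≠ 0 := by
    intro x hx h0
    refine hsimple x ?_ ?_
    · rw [← Complex.ofRealHom_eq_coe, eval_map_apply, hx, map_zero]
    · rw [derivative_map, ← Complex.ofRealHom_eq_coe, eval_map_apply, h0, map_zero]
  have h1 := hp.sum_sign_derivative hs
  have h2 := card_roots_real_add_card_nonreal hp hsimple
  set S := p.roots.toFinset with hS
  set ε : ℝ → ℤ := fun x => ((SignType.sign (p.derivative.eval x) : SignType) : ℤ) with hε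
  have hsum : ∑ v ∈ S.offDiag, ε v.1 * ε v.2 = (∑ x ∈ S, ε x) ^ 2 - S.card := by
    have h3 : ∑ v ∈ S ×ˢ S, ε v.1 * ε v.2 = (∑ x ∈ S, ε x) ^ 2 := by
      rw [Finset.sum_product, sq, Finset.sum_mul_sum]
    rw [← h3, ← Finset.diag_union_offDiag, Finset.sum_union (Finset.disjoint_diag_offDiag S)]
    have h4 : ∑ v ∈ S.diag, ε v.1 * ε v.2 = S.card := by
      rw [Finset.sum_diag, Finset.card_eq_sum_ones, Nat.cast_sum]
      refine Finset.sum_congr rfl fun x hx => ?_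
      have hx0 : p.eval x = 0 := by
        have : p.IsRoot x := by simpa [hS, hp.ne_zero] using hx
        exact this
      simp only [hε]
      rcases lt_or_gt_of_ne (hs x hx0) with h | h
      · rw [sign_neg h]; rfl
      · rw [sign_pos h]; rfl
    rw [h4]; ring
  have hdiff : ∑ v ∈ S.offDiag, ε v.1 * ε v.2 =
      ((S.offDiag.filter fun v => 0 < p.derivative.eval v.1 * p.derivative.eval v.2).card : ℤ) -
      (S.offDiag.filter fun v => p.derivative.eval v.1 * p.derivative.eval v.2 < 0).card := by
    rw [Finset.card_filter, Finset.card_filter, Nat.cast_sum, Nat.cast_sum,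
      ← Finset.sum_sub_distrib]
    refine Finset.sum_congr rfl fun v _ => ?_
    have h5 : ε v.1 * ε v.2 =
        ((SignType.sign (p.derivative.eval v.1 * p.derivative.eval v.2) : SignType) : ℤ) := by
      rw [sign_mul]; simp [hε]
    rw [h5]
    rcases lt_trichotomy (p.derivative.eval v.1 * p.derivative.eval v.2) 0 with h | h | h
    · rw [sign_neg h, if_neg h.not_gt, if_pos h]; rfl
    · rw [h]; simp
    · rw [sign_pos h, if_pos h, if_neg h.not_gt]; rfl
  rw [hsum, h1] at hdiff
  have h6 : ((p.natDegree % 2 : ℕ) : ℤ) ^ 2 = ((p.natDegree % 2 : ℕ) : ℤ) := by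
    rcases Nat.mod_two_eq_zero_or_one p.natDegree with h | h <;> rw [h] <;> rfl
  rw [h6] at hdiff
  omega

end SignCount

/-! ### Fibres of the parametrized multiplication, and the null set of multiple roots. -/

section Fibers

variable {n : ℕ}

/-- All complex roots of the real polynomial `p` are simple. -/
def HasSimpleRoots (p : ℝ[X]) : Prop :=
  ∀ β : ℂ, (p.map Complex.ofRealHom).eval β = 0 →
    (p.map Complex.ofRealHom).derivative.eval β ≠ 0

theorem ofReal_eval_map (p : ℝ[X]) (x : ℝ) :
    (p.map Complex.ofRealHom).eval (x : ℂ) = (p.eval x : ℝ) := by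
  rw [← Complex.ofRealHom_eq_coe, eval_map_apply]; rfl

theorem ext_headTwo_dropTwo {z z' : Fin (2 + n) → ℝ} (h : headTwo z = headTwo z')
    (h' : dropTwo z = dropTwo z') : z = z' := by
  rw [← append_headTwo_dropTwo z, h, h', append_headTwo_dropTwo]

theorem paramMulMap_eq_iff (ρ : (Fin 2 → ℝ) → Fin 2 → ℝ) (z y : Fin (2 + n) → ℝ) :
    paramMulMap ρ z = y ↔
      monicPoly (ρ (headTwo z)) * monicPoly (dropTwo z) = monicPoly y := by
  rw [← monicPoly_paramMulMap, monicPoly_injective.eq_iff]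

/-- The cofactor is determined by cancellation, so fibres can be counted through the roots of the
quadratic factor. -/
theorem eq_of_paramMulMap_eq {ρ : (Fin 2 → ℝ) → Fin 2 → ℝ} {z z' y : Fin (2 + n) → ℝ}
    (hz : paramMulMap ρ z = y) (hz' : paramMulMap ρ z' = y) (h : headTwo z = headTwo z') :
    z = z' := by
  refine ext_headTwo_dropTwo h (monicPoly_injective ?_)
  rw [paramMulMap_eq_iff] at hz hz'
  rw [← hz', h] at hz
  exact mul_left_cancel₀ (monicPoly_monic _).ne_zero hz

theorem exists_paramMulMap_eq {ρ : (Fin 2 → ℝ) → Fin 2 → ℝ} {v : Fin 2 → ℝ}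
    {y : Fin (2 + n) → ℝ} (h : monicPoly (ρ v) ∣ monicPoly y) :
    ∃ z, headTwo z = v ∧ paramMulMap ρ z = y := by
  obtain ⟨g, hg⟩ := h
  have hm : g.Monic := (monicPoly_monic (ρ v)).of_mul_monic_left (hg ▸ monicPoly_monic y)
  have hd : g.natDegree = n := by
    have := congrArg natDegree hg
    rw [(monicPoly_monic _).natDegree_mul hm, monicPoly_natDegree, monicPoly_natDegree] at this
    omega
  refine ⟨Fin.append v (fun i => g.coeff i), headTwo_append _ _, ?_⟩
  rw [paramMulMap_eq_iff, headTwo_append, dropTwo_append, monicPoly_coeff_eq_self hm hd, hg]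

/-- For `f = (X - x)(X - y) g` one has `f'(x) = (x - y) g(x)` and `f'(y) = (y - x) g(y)`. Hence the
sign of `realJac` can be read off from `f` and the two roots. -/
theorem realJac_eq {z y : Fin (2 + n) → ℝ} (h : paramMulMap realPair z = y) :
    (monicPoly y).derivative.eval (headTwo z 0) * (monicPoly y).derivative.eval (headTwo z 1) =
      -((headTwo z 0 - headTwo z 1) ^ 2 * realJac z) := by
  rw [paramMulMap_eq_iff, monicPoly_realPair] at h
  rw [← h, realJac]
  simp only [derivative_mul, derivative_sub, derivative_X, derivative_C, eval_add, eval_mul,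
    eval_sub, eval_X, eval_C]
  simp
  ring

/-- `Q` will be positivity or negativity; invariance under positive factors absorbs the square in
`realJac_eq`. -/
theorem encard_fiber_realPair (y : Fin (2 + n) → ℝ) (Q : ℝ → Prop) [DecidablePred Q]
    (hQ : ∀ a b, 0 < a → (Q (a * b) ↔ Q b)) :
    ({z | headTwo z 0 ≠ headTwo z 1 ∧ Q (realJac z)} ∩
        paramMulMap realPair ⁻¹' {y}).encard =
      ((monicPoly y).roots.toFinset.offDiag.filter fun v => Q
        (-((monicPoly y).derivative.eval v.1 * (monicPoly y).derivative.eval v.2))).card := by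
  have hy0 := (monicPoly_monic y).ne_zero
  have hinj : Set.InjOn (fun z : Fin (2 + n) → ℝ => (headTwo z 0, headTwo z 1))
      ({z | headTwo z 0 ≠ headTwo z 1 ∧ Q (realJac z)} ∩ paramMulMap realPair ⁻¹' {y}) := by
    intro z hz z' hz' h
    refine eq_of_paramMulMap_eq hz.2 hz'.2 ?_
    ext i
    fin_cases i
    · exact (Prod.ext_iff.1 h).1
    · exact (Prod.ext_iff.1 h).2
  have hJ : ∀ z, headTwo z 0 ≠ headTwo z 1 → paramMulMap realPair z = y →
      (Q (-((monicPoly y).derivative.eval (headTwo z 0) *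
        (monicPoly y).derivative.eval (headTwo z 1))) ↔ Q (realJac z)) := by
    intro z hne hz
    rw [realJac_eq hz, neg_neg, hQ _ _ (by have := sub_ne_zero.2 hne; positivity)]
  rw [← hinj.encard_image, ← Set.encard_coe_eq_coe_finsetCard]
  congr 1
  ext v
  simp only [Set.mem_image, Finset.coe_filter, Set.mem_ofPred_eq, Finset.mem_offDiag,
    Multiset.mem_toFinset, mem_roots hy0, IsRoot.def]
  constructor
  · rintro ⟨z, ⟨⟨hne, hq⟩, hz⟩, rfl⟩
    refine ⟨⟨?_, ?_, hne⟩, (hJ z hne hz).2 hq⟩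
    · have := (paramMulMap_eq_iff _ _ _).1 hz
      rw [← this, monicPoly_realPair]; simp
    · have := (paramMulMap_eq_iff _ _ _).1 hz
      rw [← this, monicPoly_realPair]; simp
  · rintro ⟨⟨h1, h2, hne⟩, hq⟩
    obtain ⟨z, hz, hzy⟩ := exists_paramMulMap_eq (ρ := realPair) (v := ![v.1, v.2]) (y := y) (by
      rw [monicPoly_realPair]
      refine IsCoprime.mul_dvd ?_ (dvd_iff_isRoot.2 h1) (dvd_iff_isRoot.2 h2)
      exact isCoprime_X_sub_C_of_isUnit_sub (sub_ne_zero.2 hne).isUnit)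
    have h0 : headTwo z 0 = v.1 := by rw [hz]; rfl
    have h1' : headTwo z 1 = v.2 := by rw [hz]; rfl
    have hne' : headTwo z 0 ≠ headTwo z 1 := by rwa [h0, h1']
    refine ⟨z, ⟨⟨hne', (hJ z hne' hzy).1 ?_⟩, hzy⟩, ?_⟩
    · rwa [h0, h1']
    · rw [h0, h1']

theorem monicPoly_conjPair (β : ℂ) :
    monicPoly (conjPair ![β.re, β.im]) = X ^ 2 - C (2 * β.re) * X + C (‖β‖ ^ 2) := by
  rw [← Complex.normSq_eq_norm_sq, Complex.normSq_apply]
  simp only [monicPoly, lowPoly, Fin.sum_univ_two, conjPair, Matrix.cons_val_zero,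
    Matrix.cons_val_one, Fin.val_zero, Fin.val_one, map_mul, map_neg, map_add, map_pow]
  ring

theorem derivative_eval_of_paramMulMap_conjPair {z y : Fin (2 + n) → ℝ}
    (h : paramMulMap conjPair z = y) :
    ((monicPoly y).map Complex.ofRealHom).derivative.eval
        (headTwo z 0 + headTwo z 1 * Complex.I : ℂ) =
      2 * headTwo z 1 * Complex.I * ((monicPoly (dropTwo z)).map Complex.ofRealHom).eval
        (headTwo z 0 + headTwo z 1 * Complex.I : ℂ) := by
  rw [paramMulMap_eq_iff] at h
  rw [← h, Polynomial.map_mul, monicPoly_conjPair_map]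
  simp only [derivative_mul, derivative_sub, derivative_X, derivative_C, eval_add, eval_mul,
    eval_sub, eval_X, eval_C, eval_one, eval_zero, sub_self, zero_mul, mul_zero, add_zero]
  ring

/-- Both signs of the imaginary part are allowed, so a conjugate pair counts twice. Simplicity of
the root makes the cofactor nonzero there, so no nonreal root is lost to the condition on `conjJac`.
-/
theorem encard_fiber_conjPair {y : Fin (2 + n) → ℝ} (hy : HasSimpleRoots (monicPoly y)) :
    ({z | headTwo z 1 ≠ 0 ∧ 0 < conjJac z} ∩ paramMulMap conjPair ⁻¹' {y}).encard =
      (((monicPoly y).map Complex.ofRealHom).roots.toFinset.filter fun β => β.im ≠ 0).card := by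
  have hy0 := ((monicPoly_monic y).map Complex.ofRealHom).ne_zero
  have hre : ∀ z : Fin (2 + n) → ℝ,
      (headTwo z 0 + headTwo z 1 * Complex.I : ℂ).re = headTwo z 0 := fun z => by simp
  have him : ∀ z : Fin (2 + n) → ℝ,
      (headTwo z 0 + headTwo z 1 * Complex.I : ℂ).im = headTwo z 1 := fun z => by simp
  have hinj : Set.InjOn (fun z : Fin (2 + n) → ℝ => (headTwo z 0 + headTwo z 1 * Complex.I : ℂ))
      ({z | headTwo z 1 ≠ 0 ∧ 0 < conjJac z} ∩ paramMulMap conjPair ⁻¹' {y}) := by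
    intro z hz z' hz' h
    refine eq_of_paramMulMap_eq hz.2 hz'.2 ?_
    ext i
    fin_cases i
    · exact (hre z).symm.trans ((congrArg Complex.re h).trans (hre z'))
    · exact (him z).symm.trans ((congrArg Complex.im h).trans (him z'))
  rw [← hinj.encard_image, ← Set.encard_coe_eq_coe_finsetCard]
  congr 1
  ext β
  simp only [Set.mem_image, Finset.coe_filter, Set.mem_ofPred_eq,
    Multiset.mem_toFinset, mem_roots hy0, IsRoot.def]
  constructor
  · rintro ⟨z, ⟨⟨hne, hq⟩, hz⟩, rfl⟩
    refine ⟨?_, by rwa [him]⟩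
    have := (paramMulMap_eq_iff _ _ _).1 hz
    rw [← this, Polynomial.map_mul, monicPoly_conjPair_map]; simp
  · rintro ⟨h1, hne⟩
    obtain ⟨z, hz, hzy⟩ := exists_paramMulMap_eq (ρ := conjPair) (v := ![β.re, β.im]) (y := y) (by
      rw [monicPoly_conjPair]
      refine quadratic_dvd_of_aeval_eq_zero_im_ne_zero _ ?_ hne
      rw [← h1, aeval_def, eval_map]; rfl)
    have hβ : (headTwo z 0 + headTwo z 1 * Complex.I : ℂ) = β := by
      rw [hz]; simp
    have hne' : headTwo z 1 ≠ 0 := by rwa [← him, hβ]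
    refine ⟨z, ⟨⟨hne', ?_⟩, hzy⟩, hβ⟩
    have h2 := hy β h1
    rw [← hβ, derivative_eval_of_paramMulMap_conjPair hzy] at h2
    have h3 := right_ne_zero_of_mul h2
    rw [conjJac]
    positivity

/-- A multiple real root gives a quadratic factor with `x = y`; a multiple nonreal root is also a
root of the cofactor. Either way the Jacobian vanishes at a preimage. -/
theorem mem_image_of_not_hasSimpleRoots {y : Fin (2 + n) → ℝ}
    (hy : ¬ HasSimpleRoots (monicPoly y)) :
    y ∈ paramMulMap realPair '' {z | |headTwo z 1 - headTwo z 0| * |realJac z| = 0} ∪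
      paramMulMap conjPair '' {z | 4 * |headTwo z 1| * conjJac z = 0} := by
  simp only [HasSimpleRoots, not_forall, not_not] at hy
  obtain ⟨β, h1, h2⟩ := hy
  by_cases hβ : β.im = 0
  · left
    obtain ⟨x, rfl⟩ : ∃ x : ℝ, (x : ℂ) = β := ⟨β.re, Complex.ext (by simp) (by simp [hβ])⟩
    rw [ofReal_eval_map, Complex.ofReal_eq_zero] at h1
    rw [derivative_map, ofReal_eval_map, Complex.ofReal_eq_zero] at h2
    obtain ⟨z, hz, hzy⟩ := exists_paramMulMap_eq (ρ := realPair) (v := ![x, x]) (y := y) (by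
      rw [monicPoly_realPair]
      have h3 := (one_lt_rootMultiplicity_iff_isRoot (monicPoly_monic y).ne_zero).2 ⟨h1, h2⟩
      have h4 := (le_rootMultiplicity_iff (monicPoly_monic y).ne_zero).1 (Nat.succ_le_of_lt h3)
      simpa [sq] using h4)
    refine ⟨z, ?_, hzy⟩
    simp [hz]
  · right
    obtain ⟨z, hz, hzy⟩ := exists_paramMulMap_eq (ρ := conjPair) (v := ![β.re, β.im]) (y := y) (by
      rw [monicPoly_conjPair]
      refine quadratic_dvd_of_aeval_eq_zero_im_ne_zero _ ?_ hβ
      rw [← h1, aeval_def, eval_map]; rfl)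
    have hβ' : (headTwo z 0 + headTwo z 1 * Complex.I : ℂ) = β := by
      rw [hz]; simp
    refine ⟨z, ?_, hzy⟩
    have h3 := derivative_eval_of_paramMulMap_conjPair hzy
    rw [hβ', h2] at h3
    have h4 : headTwo z 1 ≠ 0 := by rw [hz]; exact hβ
    have h5 : ((monicPoly (dropTwo z)).map Complex.ofRealHom).eval β = 0 := by
      have h6 : (2 * headTwo z 1 * Complex.I : ℂ) ≠ 0 := by simp [h4]
      exact (mul_eq_zero.1 h3.symm).resolve_left h6
    simp [conjJac, hβ', h5]

/-- Sard's lemma: the image of the critical points is a null set. -/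
theorem ae_hasSimpleRoots : ∀ᵐ y : Fin (2 + n) → ℝ, HasSimpleRoots (monicPoly y) := by
  have h1 : volume (paramMulMap realPair ''
      {z : Fin (2 + n) → ℝ | |headTwo z 1 - headTwo z 0| * |realJac z| = 0}) = 0 := by
    refine addHaar_image_eq_zero_of_det_fderivWithin_eq_zero volume
      (fun z _ => (hasFDerivAt_paramMulMap (hasFDerivAt_realPair _)).hasFDerivWithinAt) ?_
    intro z hz
    rw [← abs_eq_zero, det_realPair]
    exact hz
  have h2 : volume (paramMulMap conjPair ''
      {z : Fin (2 + n) → ℝ | 4 * |headTwo z 1| * conjJac z = 0}) = 0 := by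
    refine addHaar_image_eq_zero_of_det_fderivWithin_eq_zero volume
      (fun z _ => (hasFDerivAt_paramMulMap (hasFDerivAt_conjPair _)).hasFDerivWithinAt) ?_
    intro z hz
    rw [← abs_eq_zero, det_conjPair]
    exact hz
  refine measure_mono_null (fun y hy => mem_image_of_not_hasSimpleRoots hy)
    (measure_union_null h1 h2)

end Fibers

/-! ### The area formula with the signed Jacobian. -/

section SignedArea

variable {n : ℕ}

theorem continuous_headTwo : Continuous (headTwo : (Fin (2 + n) → ℝ) → Fin 2 → ℝ) :=
  continuous_pi fun _ => continuous_apply _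

theorem continuous_dropTwo : Continuous (dropTwo : (Fin (2 + n) → ℝ) → Fin n → ℝ) :=
  continuous_pi fun _ => continuous_apply _

theorem continuous_monicPoly_eval :
    Continuous fun v : (Fin n → ℝ) × ℝ => (monicPoly v.1).eval v.2 := by
  simp only [monicPoly, lowPoly, eval_add, eval_pow, eval_X, eval_finsetSum, eval_mul, eval_C]
  fun_prop

theorem continuous_monicPoly_map_eval :
    Continuous fun v : (Fin n → ℝ) × ℂ => ((monicPoly v.1).map Complex.ofRealHom).eval v.2 := by
  simp only [monicPoly_map]
  simp only [monicPoly, lowPoly, eval_add, eval_pow, eval_X, eval_finsetSum, eval_mul, eval_C,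
    Complex.ofRealHom_eq_coe]
  fun_prop

theorem continuous_realJac : Continuous (realJac : (Fin (2 + n) → ℝ) → ℝ) := by
  have h := fun i : Fin 2 => continuous_monicPoly_eval.comp
    (continuous_dropTwo.prodMk ((continuous_apply i).comp (continuous_headTwo (n := n))))
  exact (h 0).mul (h 1)

theorem continuous_conjJac : Continuous (conjJac : (Fin (2 + n) → ℝ) → ℝ) := by
  have h0 := fun i : Fin 2 => (continuous_apply i).comp (continuous_headTwo (n := n))
  have h := continuous_monicPoly_map_eval.comp (continuous_dropTwo.prodMk
    ((Complex.continuous_ofReal.comp (h0 0)).add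
      ((Complex.continuous_ofReal.comp (h0 1)).mul (continuous_const (y := Complex.I)))))
  exact (h.norm).pow 2

theorem card_roots_offDiag_le {y : Fin (2 + n) → ℝ} :
    (monicPoly y).roots.toFinset.offDiag.card ≤ (2 + n) * (2 + n) := by
  have h1 : (monicPoly y).roots.toFinset.card ≤ 2 + n :=
    (Multiset.toFinset_card_le _).trans ((card_roots' _).trans (monicPoly_natDegree y).le)
  rw [Finset.offDiag_card]
  exact (Nat.sub_le _ _).trans (Nat.mul_le_mul h1 h1)

/-- Integration over the pairs of a real quadratic polynomial (through its roots) and a monic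
polynomial of degree `n`, with the signed Jacobian, is integration over the monic polynomials of
degree `n + 2` up to a constant. -/
theorem integral_signed_paramMulMap {h : (Fin (2 + n) → ℝ) → ℂ} (hh : Integrable h) :
    Integrable (fun z : Fin (2 + n) → ℝ =>
      ((|headTwo z 1 - headTwo z 0| * realJac z : ℝ) : ℂ) * h (paramMulMap realPair z)) ∧
    Integrable (fun z : Fin (2 + n) → ℝ =>
      ((4 * |headTwo z 1| * conjJac z : ℝ) : ℂ) * h (paramMulMap conjPair z)) ∧
    (∫ z : Fin (2 + n) → ℝ,
      ((|headTwo z 1 - headTwo z 0| * realJac z : ℝ) : ℂ) * h (paramMulMap realPair z)) +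
    (∫ z : Fin (2 + n) → ℝ,
      ((4 * |headTwo z 1| * conjJac z : ℝ) : ℂ) * h (paramMulMap conjPair z)) =
    ((2 * ((2 + n) / 2) : ℕ) : ℂ) * ∫ y, h y := by
  classical
  set JR : (Fin (2 + n) → ℝ) → ℝ := fun z => |headTwo z 1 - headTwo z 0| * |realJac z| with hJR
  set JC : (Fin (2 + n) → ℝ) → ℝ := fun z => 4 * |headTwo z 1| * conjJac z with hJC
  have c0 : Continuous fun z : Fin (2 + n) → ℝ => headTwo z 0 :=
    continuous_apply (Fin.castAdd n 0)
  have c1 : Continuous fun z : Fin (2 + n) → ℝ => headTwo z 1 :=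
    continuous_apply (Fin.castAdd n 1)
  have mJR : Measurable JR := ((c1.sub c0).abs.mul continuous_realJac.abs).measurable
  have mJC : Measurable JC := ((continuous_const.mul c1.abs).mul continuous_conjJac).measurable
  set sP : Set (Fin (2 + n) → ℝ) := {z | headTwo z 0 ≠ headTwo z 1 ∧ 0 < realJac z} with hsP
  set sM : Set (Fin (2 + n) → ℝ) := {z | headTwo z 0 ≠ headTwo z 1 ∧ realJac z < 0} with hsM
  set sC : Set (Fin (2 + n) → ℝ) := {z | headTwo z 1 ≠ 0 ∧ 0 < conjJac z} with hsC
  have msP : MeasurableSet sP := ((isOpen_ne_fun c0 c1).inter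
    (isOpen_lt continuous_const continuous_realJac)).measurableSet
  have msM : MeasurableSet sM := ((isOpen_ne_fun c0 c1).inter
    (isOpen_lt continuous_realJac continuous_const)).measurableSet
  have msC : MeasurableSet sC := ((isOpen_ne_fun c1 continuous_const).inter
    (isOpen_lt continuous_const continuous_conjJac)).measurableSet
  have cardP := fun y : Fin (2 + n) → ℝ => encard_fiber_realPair y (fun t => 0 < t)
    (fun a b ha => by simp [ha])
  have cardM := fun y : Fin (2 + n) → ℝ => encard_fiber_realPair y (fun t => t < 0)
    (fun a b ha => by simp [mul_neg_iff, ha, ha.not_gt])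
  obtain ⟨iP, iP', eP⟩ := integral_abs_det_smul_comp_eq_integral_encard_fiber volume msP
    (fun z => hasFDerivAt_paramMulMap (hasFDerivAt_realPair _)) mJR det_realPair
    (fun z hz => mul_ne_zero (abs_ne_zero.2 (sub_ne_zero.2 hz.1.symm)) (abs_ne_zero.2 hz.2.ne'))
    (K := (2 + n) * (2 + n)) (Filter.Eventually.of_forall fun y => by
      rw [cardP]
      exact_mod_cast (Finset.card_filter_le _ _).trans card_roots_offDiag_le) hh
  obtain ⟨iM, iM', eM⟩ := integral_abs_det_smul_comp_eq_integral_encard_fiber volume msM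
    (fun z => hasFDerivAt_paramMulMap (hasFDerivAt_realPair _)) mJR det_realPair
    (fun z hz => mul_ne_zero (abs_ne_zero.2 (sub_ne_zero.2 hz.1.symm)) (abs_ne_zero.2 hz.2.ne))
    (K := (2 + n) * (2 + n)) (Filter.Eventually.of_forall fun y => by
      rw [cardM]
      exact_mod_cast (Finset.card_filter_le _ _).trans card_roots_offDiag_le) hh
  obtain ⟨iC, iC', eC⟩ := integral_abs_det_smul_comp_eq_integral_encard_fiber volume msC
    (fun z => hasFDerivAt_paramMulMap (hasFDerivAt_conjPair _)) mJC det_conjPair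
    (fun z hz => mul_ne_zero (mul_ne_zero four_ne_zero (abs_ne_zero.2 hz.1)) hz.2.ne')
    (K := 2 + n) (by
      filter_upwards [ae_hasSimpleRoots] with y hy
      rw [encard_fiber_conjPair hy]
      have := card_roots_real_add_card_nonreal (monicPoly_monic y) hy
      rw [monicPoly_natDegree] at this
      exact_mod_cast (Nat.le_add_left _ _).trans this.le) hh
  -- The area formula knows only `|det|`; the sign of `realJac` is restored as a difference of
  -- integrals over the two sets on which it is constant.
  have hR : (fun z : Fin (2 + n) → ℝ =>
      ((|headTwo z 1 - headTwo z 0| * realJac z : ℝ) : ℂ) * h (paramMulMap realPair z)) =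
      fun z => sP.indicator (fun z => (JR z : ℂ) * h (paramMulMap realPair z)) z -
        sM.indicator (fun z => (JR z : ℂ) * h (paramMulMap realPair z)) z := by
    ext z
    by_cases hne : headTwo z 0 = headTwo z 1
    · have h1 : z ∉ sP := fun hz => hz.1 hne
      have h2 : z ∉ sM := fun hz => hz.1 hne
      simp [h1, h2, hne]
    · rcases lt_trichotomy (realJac z) 0 with hz | hz | hz
      · have h1 : z ∉ sP := fun hz' => hz.not_gt hz'.2
        have h2 : z ∈ sM := ⟨hne, hz⟩
        simp [h1, h2, hJR, abs_of_neg hz]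
      · have h1 : z ∉ sP := fun hz' => hz'.2.ne' hz
        have h2 : z ∉ sM := fun hz' => hz'.2.ne hz
        simp [h1, h2, hz]
      · have h1 : z ∈ sP := ⟨hne, hz⟩
        have h2 : z ∉ sM := fun hz' => hz.not_gt hz'.2
        simp [h1, h2, hJR, abs_of_pos hz]
  have hC : (fun z : Fin (2 + n) → ℝ =>
      ((4 * |headTwo z 1| * conjJac z : ℝ) : ℂ) * h (paramMulMap conjPair z)) =
      sC.indicator (fun z => (JC z : ℂ) * h (paramMulMap conjPair z)) := by
    ext z
    by_cases hz : z ∈ sC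
    · simp [hz, hJC]
    · rw [Set.indicator_of_notMem hz]
      by_cases h1 : headTwo z 1 = 0
      · simp [h1]
      · have h2 : conjJac z = 0 := le_antisymm (not_lt.1 fun h3 => hz ⟨h1, h3⟩) (sq_nonneg _)
        simp [h2]
  rw [hR, hC, integral_sub (iP.integrable_indicator msP) (iM.integrable_indicator msM),
    integral_indicator msP, integral_indicator msM, integral_indicator msC, eP, eM, eC]
  refine ⟨(iP.integrable_indicator msP).sub (iM.integrable_indicator msM),
    iC.integrable_indicator msC, ?_⟩
  rw [← integral_sub' iP' iM', ← integral_add (iP'.sub iM') iC', ← integral_const_mul]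
  refine integral_congr_ae ?_
  filter_upwards [ae_hasSimpleRoots] with y hy
  -- The three multiplicities enter with the signs `+`, `-`, `+`, and for almost every `y` they add
  -- up to a constant.
  have hcount := card_sign_pairs (monicPoly_monic y) hy
  rw [monicPoly_natDegree] at hcount
  simp only [Pi.sub_apply, hsP, hsM, hsC]
  rw [cardP, cardM, encard_fiber_conjPair hy]
  simp only [Left.neg_pos_iff, Left.neg_neg_iff, ENat.toENNReal_coe, ENNReal.toReal_natCast,
    Complex.ofReal_natCast]
  rw [← sub_mul, ← add_mul]
  congr 1
  have hc := congrArg (fun k : ℕ => (k : ℂ)) hcount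
  simp only [Nat.cast_add] at hc
  linear_combination hc

end SignedArea

/-! ### Decay of the weights and absolute convergence. -/

section Weights

variable {Φ : ℂ[X] → ℝ} {s : ℂ} {n : ℕ}

namespace IsMultiplicativeDistance

theorem pos_of_ne_zero (hΦ : IsMultiplicativeDistance Φ) {f : ℂ[X]} (hf : f ≠ 0) : 0 < Φ f :=
  lt_of_le_of_ne (hΦ.nonneg f) fun h => hf ((hΦ.eq_zero_iff f).1 h.symm)

theorem map_one (hΦ : IsMultiplicativeDistance Φ) : Φ 1 = 1 := by
  have h1 := hΦ.map_mul 1 1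
  have h2 := (hΦ.pos_of_ne_zero (f := 1) one_ne_zero).ne'
  rw [mul_one] at h1
  exact (mul_right_cancel₀ h2 (by rw [one_mul]; exact h1)).symm

/-- By homogeneity it suffices to bound `Φ` below on the compact unit sphere, where it is continuous
and positive. The empty sphere, as for `d = 0`, is treated apart. -/
theorem exists_norm_le (hΦ : IsMultiplicativeDistance Φ) (d : ℕ) :
    ∃ κ : ℝ, 0 < κ ∧ ∀ c : Fin d → ℂ, κ * ‖c‖ ≤ Φ (lowPoly c) := by
  have hcont : Continuous fun c : Fin d → ℂ => Φ (lowPoly c) := hΦ.continuous_coeff d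
  rcases (Metric.sphere (0 : Fin d → ℂ) 1).eq_empty_or_nonempty with he | hne
  · refine ⟨1, one_pos, fun c => ?_⟩
    have hc : ‖c‖ = 0 := by
      by_contra h
      have : ((‖c‖ : ℂ)⁻¹ • c) ∈ Metric.sphere (0 : Fin d → ℂ) 1 := by
        simp [norm_smul, h]
      rw [he] at this
      exact this
    rw [hc, mul_zero]
    exact hΦ.nonneg _
  · obtain ⟨c₀, hc₀, hmin⟩ := (isCompact_sphere (0 : Fin d → ℂ) 1).exists_isMinOn hne
      hcont.continuousOn
    have hpos : 0 < Φ (lowPoly c₀) := by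
      refine hΦ.pos_of_ne_zero fun h0 => ?_
      have hz : c₀ = 0 := by
        ext i
        have := congrArg (fun p : ℂ[X] => p.coeff i) h0
        simpa [lowPoly_coeff] using this
      rw [hz] at hc₀
      simp at hc₀
    refine ⟨Φ (lowPoly c₀), hpos, fun c => ?_⟩
    by_cases hc : ‖c‖ = 0
    · rw [hc, mul_zero]; exact hΦ.nonneg _
    · have hmem : ((‖c‖ : ℂ)⁻¹ • c) ∈ Metric.sphere (0 : Fin d → ℂ) 1 := by
        simp [norm_smul, hc]
      have h1 : Φ (lowPoly c₀) ≤ Φ (lowPoly ((‖c‖ : ℂ)⁻¹ • c)) := hmin hmem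
      rw [lowPoly_smul, hΦ.map_smul, norm_inv, Complex.norm_real, norm_norm] at h1
      have h2 : 0 < ‖c‖ := lt_of_le_of_ne (norm_nonneg c) (Ne.symm hc)
      rwa [inv_mul_eq_div, le_div_iff₀ h2] at h1

end IsMultiplicativeDistance

theorem monicPoly_eq_lowPoly_snoc {R : Type*} [CommRing R] (b : Fin n → R) :
    monicPoly b = lowPoly (Fin.snoc b (1 : R) : Fin (n + 1) → R) := by
  rw [lowPoly, Fin.sum_univ_castSucc, monicPoly, lowPoly]
  simp [add_comm]

theorem IsMultiplicativeDistance.continuous_monicPoly (hΦ : IsMultiplicativeDistance Φ) :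
    Continuous fun b : Fin n → ℂ => Φ (monicPoly b) := by
  simp only [monicPoly_eq_lowPoly_snoc]
  refine (hΦ.continuous_coeff (n + 1)).comp (continuous_pi fun i => ?_)
  refine Fin.lastCases ?_ (fun i => ?_) i
  · simp only [Fin.snoc_last]; exact continuous_const
  · simp only [Fin.snoc_castSucc]; exact continuous_apply i

theorem IsMultiplicativeDistance.exists_le_monicPoly (hΦ : IsMultiplicativeDistance Φ) (n : ℕ) :
    ∃ κ : ℝ, 0 < κ ∧ ∀ b : Fin n → ℂ, κ * (1 + ‖b‖) ≤ Φ (monicPoly b) := by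
  obtain ⟨κ, hκ, h⟩ := hΦ.exists_norm_le (n + 1)
  -- With the leading coefficient `1` included, the norm of the coefficient vector dominates both
  -- `1` and `‖b‖`, hence half of their sum.
  refine ⟨κ / 2, by positivity, fun b => ?_⟩
  rw [monicPoly_eq_lowPoly_snoc]
  refine le_trans ?_ (h _)
  set c : Fin (n + 1) → ℂ := Fin.snoc b 1 with hc
  have h1 : 1 ≤ ‖c‖ := by
    have := norm_le_pi_norm c (Fin.last n)
    simpa [hc] using this
  have h2 : ‖b‖ ≤ ‖c‖ := by
    refine (pi_norm_le_iff_of_nonneg (norm_nonneg _)).2 fun i => ?_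
    have := norm_le_pi_norm c i.castSucc
    simpa [hc] using this
  nlinarith

/-- `Φ(f)^{-s}`. -/
def polyWeight (Φ : ℂ[X] → ℝ) (s : ℂ) (f : ℂ[X]) : ℂ := (Φ f : ℂ) ^ (-s)

theorem IsMultiplicativeDistance.polyWeight_mul (hΦ : IsMultiplicativeDistance Φ) (f g : ℂ[X]) :
    polyWeight Φ s (f * g) = polyWeight Φ s f * polyWeight Φ s g := by
  rw [polyWeight, hΦ.map_mul, Complex.ofReal_mul,
    Complex.mul_cpow_ofReal_nonneg (hΦ.nonneg f) (hΦ.nonneg g)]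
  rfl

theorem IsMultiplicativeDistance.polyWeight_one (hΦ : IsMultiplicativeDistance Φ) :
    polyWeight Φ s 1 = 1 := by
  simp [polyWeight, hΦ.map_one]

theorem rootWeight_eq_polyWeight (γ : ℂ) : rootWeight Φ s γ = polyWeight Φ s (X - C γ) := rfl

theorem IsMultiplicativeDistance.continuous_polyWeight (hΦ : IsMultiplicativeDistance Φ) :
    Continuous fun b : Fin n → ℂ => polyWeight Φ s (monicPoly b) := by
  refine Continuous.cpow (Complex.continuous_ofReal.comp hΦ.continuous_monicPoly)
    continuous_const fun b => ?_
  simp [Complex.mem_slitPlane_iff, hΦ.pos_of_ne_zero (monicPoly_monic b).ne_zero]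

theorem IsMultiplicativeDistance.exists_norm_polyWeight_le (hΦ : IsMultiplicativeDistance Φ)
    (n : ℕ) {s : ℂ} (hs : 0 ≤ s.re) : ∃ K : ℝ, 0 ≤ K ∧ ∀ b : Fin n → ℂ,
      ‖polyWeight Φ s (monicPoly b)‖ ≤ K * (1 + ‖b‖) ^ (-s.re) := by
  obtain ⟨κ, hκ, h⟩ := hΦ.exists_le_monicPoly n
  refine ⟨κ ^ (-s.re), by positivity, fun b => ?_⟩
  have hpos := hΦ.pos_of_ne_zero (monicPoly_monic b).ne_zero
  rw [polyWeight, Complex.norm_cpow_eq_rpow_re_of_pos hpos, Complex.neg_re,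
    ← Real.mul_rpow hκ.le (by positivity)]
  exact Real.rpow_le_rpow_of_nonpos (by positivity) (h b) (by linarith)

theorem monicPoly_linear {R : Type*} [CommRing R] (γ : R) :
    monicPoly (fun _ : Fin 1 => -γ) = X - C γ := by
  simp [monicPoly, lowPoly, sub_eq_add_neg]

theorem IsMultiplicativeDistance.continuous_rootWeight (hΦ : IsMultiplicativeDistance Φ) :
    Continuous (rootWeight Φ s) := by
  have h : rootWeight Φ s =
      fun γ => polyWeight Φ s (monicPoly (fun _ : Fin 1 => -γ)) := by
    ext γ; rw [monicPoly_linear, rootWeight_eq_polyWeight]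
  rw [h]
  exact hΦ.continuous_polyWeight.comp (continuous_pi fun _ => continuous_neg)

theorem IsMultiplicativeDistance.exists_norm_rootWeight_le (hΦ : IsMultiplicativeDistance Φ)
    {s : ℂ} (hs : 0 ≤ s.re) : ∃ K : ℝ, 0 ≤ K ∧ ∀ γ : ℂ,
      ‖rootWeight Φ s γ‖ ≤ K * (1 + ‖γ‖) ^ (-s.re) := by
  obtain ⟨K, hK, h⟩ := hΦ.exists_norm_polyWeight_le 1 hs
  refine ⟨K, hK, fun γ => ?_⟩
  have := h (fun _ => -γ)
  rw [monicPoly_linear, ← rootWeight_eq_polyWeight] at this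
  simpa using this

theorem exists_norm_eval_le (P : ℂ[X]) :
    ∃ K : ℝ, 0 ≤ K ∧ ∀ γ : ℂ, ‖P.eval γ‖ ≤ K * (1 + ‖γ‖) ^ P.natDegree := by
  refine ⟨∑ i ∈ Finset.range (P.natDegree + 1), ‖P.coeff i‖, by positivity, fun γ => ?_⟩
  rw [eval_eq_sum_range, Finset.sum_mul]
  refine (norm_sum_le _ _).trans (Finset.sum_le_sum fun i hi => ?_)
  rw [norm_mul, norm_pow]
  gcongr
  refine (pow_le_pow_left₀ (norm_nonneg γ) (by linarith) i).trans
    (pow_le_pow_right₀ (by linarith [norm_nonneg γ]) ?_)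
  simpa [Nat.lt_succ_iff] using hi

/-- The integrand `φ(γ)^{-s} P(γ)` is `O((1 + |γ|)^{-(Re s - deg P)})`. -/
theorem IsMultiplicativeDistance.exists_norm_rootWeight_mul_eval_le
    (hΦ : IsMultiplicativeDistance Φ) {s : ℂ} (hs : 0 ≤ s.re) (P : ℂ[X]) :
    ∃ K : ℝ, 0 ≤ K ∧ ∀ γ : ℂ,
      ‖rootWeight Φ s γ * P.eval γ‖ ≤ K * (1 + ‖γ‖) ^ (-(s.re - P.natDegree)) := by
  obtain ⟨K, hK, h⟩ := hΦ.exists_norm_rootWeight_le hs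
  obtain ⟨K', hK', h'⟩ := exists_norm_eval_le P
  refine ⟨K * K', by positivity, fun γ => ?_⟩
  rw [norm_mul]
  refine (mul_le_mul (h γ) (h' γ) (norm_nonneg _) (by positivity)).trans_eq ?_
  rw [neg_sub, sub_eq_neg_add, Real.rpow_add (by positivity), Real.rpow_natCast]
  ring

theorem IsMultiplicativeDistance.integrable_border (hΦ : IsMultiplicativeDistance Φ) {s : ℂ}
    {P : ℂ[X]} (hP : (P.natDegree : ℝ) + 1 < s.re) : Integrable (borderIntegrand Φ s P) := by
  have hs : 0 ≤ s.re := by have : (0 : ℝ) ≤ P.natDegree := by positivity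
                           linarith
  obtain ⟨K, hK, h⟩ := hΦ.exists_norm_rootWeight_mul_eval_le hs P
  have hInt : Integrable fun x : ℝ => K * (1 + ‖x‖) ^ (-(s.re - P.natDegree)) :=
    (integrable_one_add_norm (by simp; linarith)).const_mul K
  refine hInt.mono' ?_ (Filter.Eventually.of_forall fun x => ?_)
  · exact ((hΦ.continuous_rootWeight.comp Complex.continuous_ofReal).mul
      (P.continuous.comp Complex.continuous_ofReal)).aestronglyMeasurable
  · simpa [borderIntegrand] using h x

theorem measurable_real_sign : Measurable Real.sign := by
  unfold Real.sign
  exact Measurable.ite measurableSet_Iio measurable_const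
    (Measurable.ite measurableSet_Ioi measurable_const measurable_const)

theorem norm_real_sign_le (x : ℝ) : ‖(Real.sign x : ℂ)‖ ≤ 1 := by
  rcases Real.sign_apply_eq x with h | h | h <;> simp [h]

theorem IsMultiplicativeDistance.integrable_realForm (hΦ : IsMultiplicativeDistance Φ) {s : ℂ}
    {P Q : ℂ[X]} (hP : (P.natDegree : ℝ) + 1 < s.re) (hQ : (Q.natDegree : ℝ) + 1 < s.re) :
    Integrable (realFormIntegrand Φ s P Q) := by
  have h := (hΦ.integrable_border hP).mul_prod (hΦ.integrable_border hQ)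
  have h2 := h.bdd_mul (c := 1) (f := fun z : ℝ × ℝ => (Real.sign (z.2 - z.1) : ℂ))
    (Complex.measurable_ofReal.comp (measurable_real_sign.comp
      (measurable_snd.sub measurable_fst))).aestronglyMeasurable
    (Filter.Eventually.of_forall fun z => norm_real_sign_le _)
  refine h2.congr (Filter.Eventually.of_forall fun z => ?_)
  simp only [realFormIntegrand, borderIntegrand]
  ring

theorem IsMultiplicativeDistance.integrable_complexForm (hΦ : IsMultiplicativeDistance Φ) {s : ℂ}
    {P Q : ℂ[X]} (hP : (P.natDegree : ℝ) + 1 < s.re) (hQ : (Q.natDegree : ℝ) + 1 < s.re) :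
    Integrable (complexFormIntegrand Φ s P Q) := by
  have hs : 0 ≤ s.re := by have : (0 : ℝ) ≤ P.natDegree := by positivity
                           linarith
  obtain ⟨K, hK, h⟩ := hΦ.exists_norm_rootWeight_mul_eval_le hs P
  obtain ⟨K', hK', h'⟩ := hΦ.exists_norm_rootWeight_mul_eval_le hs Q
  -- Each of the two decay exponents exceeds `1`, so their sum exceeds the real dimension `2` of
  -- `ℂ`.
  have hInt : Integrable fun β : ℂ =>
      (K * K') * (1 + ‖β‖) ^ (-(s.re - P.natDegree + (s.re - Q.natDegree))) :=
    (integrable_one_add_norm (by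
      rw [Complex.finrank_real_complex]; push_cast; linarith)).const_mul _
  refine hInt.mono' ?_ (Filter.Eventually.of_forall fun β => ?_)
  · refine Measurable.aestronglyMeasurable ?_
    have hc := hΦ.continuous_rootWeight (s := s)
    refine Measurable.mul ?_ (Complex.measurable_ofReal.comp
      (measurable_real_sign.comp Complex.measurable_im))
    exact (((hc.mul (hc.comp Complex.continuous_conj)).mul
      (P.continuous.comp Complex.continuous_conj)).mul Q.continuous).measurable
  · have h1 := h (starRingEnd ℂ β)
    rw [RCLike.norm_conj] at h1
    have h2 : complexFormIntegrand Φ s P Q β =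
        (rootWeight Φ s (starRingEnd ℂ β) * P.eval (starRingEnd ℂ β)) *
        (rootWeight Φ s β * Q.eval β) * (Real.sign β.im : ℂ) := by
      rw [complexFormIntegrand]; ring
    rw [h2, norm_mul, norm_mul]
    refine (mul_le_of_le_one_right (by positivity) (norm_real_sign_le _)).trans ?_
    refine (mul_le_mul h1 (h' β) (norm_nonneg _) (by positivity)).trans_eq ?_
    rw [neg_add, Real.rpow_add (by positivity)]
    ring

/-- The weight of a real monic polynomial times its values at `m` points. -/
def momentWeight (Φ : ℂ[X] → ℝ) (s : ℂ) (m : ℕ) (z : ℕ → ℂ) (f : ℂ[X]) : ℂ :=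
  polyWeight Φ s f * ∏ i ∈ Finset.range m, f.eval (z i)

/-- The weight splits along `f = q g`; this is where multiplicativity of `Φ` enters the recursion.
-/
theorem IsMultiplicativeDistance.momentWeight_mul (hΦ : IsMultiplicativeDistance Φ) (m : ℕ)
    (z : ℕ → ℂ) (f g : ℂ[X]) :
    momentWeight Φ s m z (f * g) = momentWeight Φ s m z f * momentWeight Φ s m z g := by
  simp only [momentWeight, hΦ.polyWeight_mul, eval_mul, Finset.prod_mul_distrib]
  ring

theorem exists_norm_monicPoly_eval_le (n : ℕ) (γ : ℂ) :
    ∃ K : ℝ, 0 ≤ K ∧ ∀ b : Fin n → ℂ, ‖(monicPoly b).eval γ‖ ≤ K * (1 + ‖b‖) := by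
  refine ⟨‖γ‖ ^ n + ∑ i : Fin n, ‖γ‖ ^ (i : ℕ), by positivity, fun b => ?_⟩
  simp only [monicPoly, lowPoly, eval_add, eval_pow, eval_X, eval_finsetSum, eval_mul, eval_C]
  rw [add_mul]
  refine (norm_add_le _ _).trans (add_le_add ?_ ?_)
  · rw [norm_pow]
    exact le_mul_of_one_le_right (by positivity) (by linarith [norm_nonneg b])
  · rw [Finset.sum_mul]
    refine (norm_sum_le _ _).trans (Finset.sum_le_sum fun i _ => ?_)
    rw [norm_mul, norm_pow, mul_comm]
    gcongr
    linarith [norm_le_pi_norm b i]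

/-- Every evaluation point costs one power of `1 + ‖b‖`, so the exponent `Re s - m` has to exceed
the dimension `n`. The recursion preserves `n + m`. -/
theorem IsMultiplicativeDistance.integrable_momentWeight (hΦ : IsMultiplicativeDistance Φ) {s : ℂ}
    {n m : ℕ} (hs : ((n + m : ℕ) : ℝ) < s.re) (z : ℕ → ℂ) :
    Integrable fun b : Fin n → ℝ => momentWeight Φ s m z ((monicPoly b).map Complex.ofRealHom) := by
  have hs0 : 0 ≤ s.re := by have : (0 : ℝ) ≤ ((n + m : ℕ) : ℝ) := by positivity
                            linarith
  obtain ⟨K, hK, h⟩ := hΦ.exists_norm_polyWeight_le n hs0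
  choose L hL h' using fun i => exists_norm_monicPoly_eval_le n (z i)
  have hInt : Integrable fun b : Fin n → ℝ =>
      (K * ∏ i ∈ Finset.range m, L i) * (1 + ‖b‖) ^ (-(s.re - m)) :=
    (integrable_one_add_norm (by simp; push_cast at hs; linarith)).const_mul _
  have hofReal : Continuous fun (b : Fin n → ℝ) (i : Fin n) => (Complex.ofRealHom (b i) : ℂ) :=
    continuous_pi fun i => Complex.continuous_ofReal.comp (continuous_apply i)
  refine hInt.mono' ?_ (Filter.Eventually.of_forall fun b => ?_)
  · refine Continuous.aestronglyMeasurable ?_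
    simp only [momentWeight]
    refine Continuous.mul ?_ (continuous_finsetProd _ fun i _ => ?_)
    · simp only [monicPoly_map]
      exact hΦ.continuous_polyWeight.comp hofReal
    · exact continuous_monicPoly_map_eval.comp (continuous_id.prodMk continuous_const)
  · have hb : ‖fun i => (Complex.ofRealHom (b i) : ℂ)‖ = ‖b‖ := by
      simp [Pi.norm_def]
    rw [monicPoly_map, momentWeight, norm_mul, norm_prod]
    have h1 := h fun i => Complex.ofRealHom (b i)
    have h2 : ∏ i ∈ Finset.range m, ‖(monicPoly fun i => Complex.ofRealHom (b i)).eval (z i)‖ ≤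
        ∏ i ∈ Finset.range m, (L i * (1 + ‖b‖)) :=
      Finset.prod_le_prod (fun _ _ => norm_nonneg _) fun i _ => by
        have := h' i fun j => Complex.ofRealHom (b j)
        rwa [hb] at this
    rw [hb] at h1
    refine (mul_le_mul h1 h2 (Finset.prod_nonneg fun _ _ => norm_nonneg _)
      (by positivity)).trans_eq ?_
    rw [Finset.prod_mul_distrib, Finset.prod_const, Finset.card_range, neg_sub, sub_eq_neg_add,
      Real.rpow_add (by positivity), Real.rpow_natCast]
    ring

end Weights

/-! ### The recursion that splits off a quadratic factor. -/

section Step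

variable {Φ : ℂ[X] → ℝ} {s : ℂ} {n : ℕ}

theorem measurePreserving_headTwo_dropTwo :
    MeasurePreserving (fun z : Fin (2 + n) → ℝ => (headTwo z, dropTwo z)) volume volume := by
  have h1 := (volume_measurePreserving_piCongrLeft (fun _ : Fin (2 + n) => ℝ)
    (finSumFinEquiv (m := 2) (n := n))).symm
  have h2 := volume_measurePreserving_sumPiEquivProdPi (fun _ : Fin 2 ⊕ Fin n => ℝ)
  exact h2.comp h1

theorem measurableEmbedding_headTwo_dropTwo :
    MeasurableEmbedding (fun z : Fin (2 + n) → ℝ => (headTwo z, dropTwo z)) :=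
  ((MeasurableEquiv.piCongrLeft (fun _ : Fin (2 + n) => ℝ)
    (finSumFinEquiv (m := 2) (n := n))).symm.trans
      (MeasurableEquiv.sumPiEquivProdPi (fun _ : Fin 2 ⊕ Fin n => ℝ))).measurableEmbedding

theorem integral_headTwo_dropTwo {G : (Fin 2 → ℝ) → (Fin n → ℝ) → ℂ}
    (hG : Integrable fun z : Fin (2 + n) → ℝ => G (headTwo z) (dropTwo z)) :
    ∫ z : Fin (2 + n) → ℝ, G (headTwo z) (dropTwo z) = ∫ a, ∫ b, G a b := by
  have h1 := measurePreserving_headTwo_dropTwo.integral_comp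
    (measurableEmbedding_headTwo_dropTwo (n := n)) (fun v => G v.1 v.2)
  have h2 : Integrable (fun v : (Fin 2 → ℝ) × (Fin n → ℝ) => G v.1 v.2) :=
    (measurePreserving_headTwo_dropTwo.integrable_comp_emb
      measurableEmbedding_headTwo_dropTwo).1 hG
  rw [h1]
  exact integral_prod _ h2

/-- The sequence `z` with the entries `m`, `m + 1` replaced by `a`, `b`. -/
def updateTwo (z : ℕ → ℂ) (m : ℕ) (a b : ℂ) : ℕ → ℂ :=
  Function.update (Function.update z m a) (m + 1) b

theorem updateTwo_of_lt {z : ℕ → ℂ} {m i : ℕ} {a b : ℂ} (h : i < m) :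
    updateTwo z m a b i = z i := by
  rw [updateTwo, Function.update_of_ne (by omega), Function.update_of_ne (by omega)]

theorem updateTwo_self {z : ℕ → ℂ} {m : ℕ} {a b : ℂ} : updateTwo z m a b m = a := by
  rw [updateTwo, Function.update_of_ne (by omega), Function.update_self]

theorem updateTwo_succ {z : ℕ → ℂ} {m : ℕ} {a b : ℂ} : updateTwo z m a b (m + 1) = b := by
  rw [updateTwo, Function.update_self]

/-- Applied to the cofactor, this absorbs the Jacobian factor `g(a) g(b)` into the weight as two new
evaluation points. -/
theorem momentWeight_updateTwo (z : ℕ → ℂ) (m : ℕ) (a b : ℂ) (f : ℂ[X]) :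
    momentWeight Φ s (m + 2) (updateTwo z m a b) f =
      momentWeight Φ s m z f * (f.eval a * f.eval b) := by
  rw [momentWeight, Finset.prod_range_succ, Finset.prod_range_succ, updateTwo_self, updateTwo_succ,
    momentWeight, Finset.prod_congr rfl fun i hi => by rw [updateTwo_of_lt (Finset.mem_range.1 hi)]]
  ring

/-- The moment of the weight `momentWeight` over the real monic polynomials of degree `n`. -/
def pointMoment (Φ : ℂ[X] → ℝ) (s : ℂ) (n m : ℕ) (z : ℕ → ℂ) : ℂ :=
  ∫ b : Fin n → ℝ, momentWeight Φ s m z ((monicPoly b).map Complex.ofRealHom)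

/-- The recursion for `pointMoment`, splitting off a real quadratic factor. -/
theorem IsMultiplicativeDistance.pointMoment_add_two (hΦ : IsMultiplicativeDistance Φ) {m : ℕ}
    (hs : ((2 + n + m : ℕ) : ℝ) < s.re) (z : ℕ → ℂ) :
    ((2 * ((2 + n) / 2) : ℕ) : ℂ) * pointMoment Φ s (2 + n) m z =
      (∫ v : ℝ × ℝ, (|v.2 - v.1| : ℝ) *
        (momentWeight Φ s m z (X - C (v.1 : ℂ)) * momentWeight Φ s m z (X - C (v.2 : ℂ))) *
          pointMoment Φ s n (m + 2) (updateTwo z m v.1 v.2)) +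
      ∫ β : ℂ, (4 * |β.im| : ℝ) *
        (momentWeight Φ s m z (X - C (starRingEnd ℂ β)) * momentWeight Φ s m z (X - C β)) *
          pointMoment Φ s n (m + 2) (updateTwo z m (starRingEnd ℂ β) β) := by
  have hInt := hΦ.integrable_momentWeight hs z
  obtain ⟨iR, iC, hsum⟩ := integral_signed_paramMulMap hInt
  rw [pointMoment, ← hsum]
  -- `GR` and `GC` are the two integrands with the quadratic factor and the cofactor as separate
  -- variables; by Fubini the inner integral is a `pointMoment` of degree `n`.
  let GR : (Fin 2 → ℝ) → (Fin n → ℝ) → ℂ := fun a b => (|a 1 - a 0| : ℝ) *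
    (momentWeight Φ s m z (X - C (a 0 : ℂ)) * momentWeight Φ s m z (X - C (a 1 : ℂ))) *
      momentWeight Φ s (m + 2) (updateTwo z m (a 0) (a 1)) ((monicPoly b).map Complex.ofRealHom)
  let GC : (Fin 2 → ℝ) → (Fin n → ℝ) → ℂ := fun a b => (4 * |a 1| : ℝ) *
    (momentWeight Φ s m z (X - C (a 0 - a 1 * Complex.I : ℂ)) *
      momentWeight Φ s m z (X - C (a 0 + a 1 * Complex.I : ℂ))) *
      momentWeight Φ s (m + 2) (updateTwo z m (a 0 - a 1 * Complex.I) (a 0 + a 1 * Complex.I))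
        ((monicPoly b).map Complex.ofRealHom)
  have eR : (fun z' : Fin (2 + n) → ℝ =>
      ((|headTwo z' 1 - headTwo z' 0| * realJac z' : ℝ) : ℂ) * momentWeight Φ s m z
        ((monicPoly (paramMulMap realPair z')).map Complex.ofRealHom)) =
      fun z' => GR (headTwo z') (dropTwo z') := by
    ext z'
    dsimp only [GR]
    rw [monicPoly_paramMulMap, Polynomial.map_mul, monicPoly_realPair_map, hΦ.momentWeight_mul,
      hΦ.momentWeight_mul, momentWeight_updateTwo, ofReal_eval_map, ofReal_eval_map,
      ← Complex.ofReal_mul, ← realJac]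
    push_cast
    ring
  have eC : (fun z' : Fin (2 + n) → ℝ =>
      ((4 * |headTwo z' 1| * conjJac z' : ℝ) : ℂ) * momentWeight Φ s m z
        ((monicPoly (paramMulMap conjPair z')).map Complex.ofRealHom)) =
      fun z' => GC (headTwo z') (dropTwo z') := by
    ext z'
    dsimp only [GC]
    have h3 : (headTwo z' 0 - headTwo z' 1 * Complex.I : ℂ) =
        starRingEnd ℂ (headTwo z' 0 + headTwo z' 1 * Complex.I : ℂ) := by
      simp [sub_eq_add_neg]
    have h4 : ((monicPoly (dropTwo z')).map Complex.ofRealHom).eval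
          (headTwo z' 0 - headTwo z' 1 * Complex.I : ℂ) *
        ((monicPoly (dropTwo z')).map Complex.ofRealHom).eval
          (headTwo z' 0 + headTwo z' 1 * Complex.I : ℂ) = (conjJac z' : ℂ) := by
      rw [h3, eval_map_ofReal_conj, Complex.conj_mul', conjJac, Complex.ofReal_pow]
    rw [monicPoly_paramMulMap, Polynomial.map_mul, monicPoly_conjPair_map, hΦ.momentWeight_mul,
      hΦ.momentWeight_mul, momentWeight_updateTwo, h4]
    push_cast
    ring
  rw [eR] at iR ⊢
  rw [eC] at iC ⊢
  rw [integral_headTwo_dropTwo (G := GR) iR, integral_headTwo_dropTwo (G := GC) iC]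
  simp only [GR, GC, integral_const_mul]
  congr 1
  · rw [← (volume_preserving_finTwoArrow ℝ).symm.integral_comp
      (MeasurableEquiv.finTwoArrow (α := ℝ)).symm.measurableEmbedding]
    rfl
  · rw [← Complex.volume_preserving_equiv_pi.integral_comp
      Complex.measurableEquivPi.measurableEmbedding]
    refine integral_congr_ae (Filter.Eventually.of_forall fun β => ?_)
    have h1 : ((β.re : ℂ) - β.im * Complex.I) = starRingEnd ℂ β := by
      apply Complex.ext <;> simp
    have h2 : ((β.re : ℂ) + β.im * Complex.I) = β := Complex.re_add_im β
    simp only [Complex.measurableEquivPi_apply, Matrix.cons_val_zero, Matrix.cons_val_one, h1, h2]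
    rfl

end Step

/-! ### Vandermonde products and their expansion in the family `P`. -/

section Vandermonde

/-- The Vandermonde product `∏_{i < j < m} (z j - z i)`. -/
def vandermondeProd (m : ℕ) (z : ℕ → ℂ) : ℂ :=
  ∏ j ∈ Finset.range m, ∏ i ∈ Finset.range j, (z j - z i)

theorem vandermondeProd_congr {m : ℕ} {z z' : ℕ → ℂ} (h : ∀ i < m, z i = z' i) :
    vandermondeProd m z = vandermondeProd m z' := by
  refine Finset.prod_congr rfl fun j hj => Finset.prod_congr rfl fun i hi => ?_
  rw [Finset.mem_range] at hi hj
  rw [h i (by omega), h j hj]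

theorem vandermondeProd_succ (m : ℕ) (z : ℕ → ℂ) :
    vandermondeProd (m + 1) z = vandermondeProd m z * ∏ i ∈ Finset.range m, (z m - z i) :=
  Finset.prod_range_succ _ _

theorem vandermondeProd_update (m : ℕ) (z : ℕ → ℂ) (a : ℂ) :
    vandermondeProd (m + 1) (Function.update z m a) =
      vandermondeProd m z * ∏ i ∈ Finset.range m, (a - z i) := by
  rw [vandermondeProd_succ, Function.update_self, vandermondeProd_congr (z' := z)
    fun i hi => Function.update_of_ne hi.ne _ _]
  congr 1
  refine Finset.prod_congr rfl fun i hi => ?_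
  rw [Function.update_of_ne (Finset.mem_range.1 hi).ne]

/-- The differences are written as `z i - a`, the value of `X - a` at `z i`. Reversing them for both
new points produces `(-1)^m` twice. -/
theorem vandermondeProd_updateTwo (m : ℕ) (z : ℕ → ℂ) (a b : ℂ) :
    vandermondeProd (m + 2) (updateTwo z m a b) =
      vandermondeProd m z * (∏ i ∈ Finset.range m, (z i - a)) *
        (∏ i ∈ Finset.range m, (z i - b)) * (b - a) := by
  rw [updateTwo, vandermondeProd_update, vandermondeProd_update, Finset.prod_range_succ,
    Function.update_self]
  have h0 : ∏ i ∈ Finset.range m, (b - Function.update z m a i) =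
      ∏ i ∈ Finset.range m, (b - z i) := Finset.prod_congr rfl fun i hi => by
    rw [Function.update_of_ne (Finset.mem_range.1 hi).ne]
  rw [h0]
  have h : ∀ c : ℂ, ∏ i ∈ Finset.range m, (c - z i) =
      (-1) ^ m * ∏ i ∈ Finset.range m, (z i - c) := fun c => by
    rw [Finset.prod_congr rfl fun i _ => show c - z i = -1 * (z i - c) by ring,
      Finset.prod_mul_distrib, Finset.prod_const, Finset.card_range]
  rw [h a, h b]
  have h2 : ((-1 : ℂ) ^ m) * (-1) ^ m = 1 := by rw [← mul_pow]; simp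
  linear_combination (vandermondeProd m z * (∏ i ∈ Finset.range m, (z i - a)) *
        (∏ i ∈ Finset.range m, (z i - b)) * (b - a)) * h2

theorem vandermondeProd_eq_det (m : ℕ) (z : ℕ → ℂ) :
    vandermondeProd m z = (Matrix.vandermonde fun i : Fin m => z i).det := by
  rw [Matrix.det_vandermonde, Finset.prod_comm' (t' := Finset.univ) (s' := fun j => Finset.Iio j)
    (by simp), vandermondeProd, Finset.prod_range]
  refine Finset.prod_congr rfl fun j _ => ?_
  have h : Finset.range (j : ℕ) = (Finset.Iio j).map Fin.valEmbedding := by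
    rw [Fin.map_valEmbedding_Iio, Nat.Iio_eq_range]
  rw [h, Finset.prod_map]
  rfl

/-- The value at the position `i` of a permutation of `{0, …, K - 1}`, as a natural number. -/
def permVal {K : ℕ} (τ : Equiv.Perm (Fin K)) (i : ℕ) : ℕ := if h : i < K then τ ⟨i, h⟩ else 0

theorem permVal_fin {K : ℕ} (τ : Equiv.Perm (Fin K)) (i : Fin K) : permVal τ i = τ i := by
  simp [permVal]

/-- A family of polynomials indexed by `Fin N`, extended by zero. -/
def extendFamily {N : ℕ} (P : Fin N → ℂ[X]) (k : ℕ) : ℂ[X] := if h : k < N then P ⟨k, h⟩ else 0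

theorem extendFamily_fin {N : ℕ} (P : Fin N → ℂ[X]) (k : Fin N) : extendFamily P k = P k := by
  simp [extendFamily]

theorem vandermondeProd_eq_det_eval {N : ℕ} {P : Fin N → ℂ[X]} (hP : IsCompleteMonicFamily P)
    (z : ℕ → ℂ) :
    vandermondeProd N z = (Matrix.of fun i j : Fin N => (P j).eval (z i)).det := by
  rw [vandermondeProd_eq_det, Matrix.det_eval_matrixOfPolynomials_eq_det_vandermonde _ P
    (fun i => (hP i).2) fun i => (hP i).1]

theorem vandermondeProd_eq_sum {N : ℕ} {P : Fin N → ℂ[X]} (hP : IsCompleteMonicFamily P)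
    (z : ℕ → ℂ) :
    vandermondeProd N z = ∑ τ : Equiv.Perm (Fin N), ((Equiv.Perm.sign τ : ℤ) : ℂ) *
      ∏ i ∈ Finset.range N, (extendFamily P (permVal τ i)).eval (z i) := by
  rw [vandermondeProd_eq_det_eval hP, ← Matrix.det_transpose, Matrix.det_apply']
  refine Finset.sum_congr rfl fun τ _ => ?_
  rw [Finset.prod_range]
  congr 1
  refine Finset.prod_congr rfl fun i _ => ?_
  rw [permVal_fin, extendFamily_fin]
  rfl

/-- Bordering the determinant by a last row that is a unit vector does not change it. For odd `N`
the sum then runs over permutations of `N + 1 = 2J` positions, as in the Pfaffian. -/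
theorem vandermondeProd_eq_sum_bordered {N : ℕ} {P : Fin N → ℂ[X]} (hP : IsCompleteMonicFamily P)
    (z : ℕ → ℂ) :
    vandermondeProd N z = ∑ τ : Equiv.Perm (Fin (N + 1)), ((Equiv.Perm.sign τ : ℤ) : ℂ) *
      (∏ i ∈ Finset.range N, (extendFamily P (permVal τ i)).eval (z i)) *
        if permVal τ N = N then 1 else 0 := by
  let M : Matrix (Fin (N + 1)) (Fin (N + 1)) ℂ := Matrix.of fun i j =>
    if (i : ℕ) < N then (extendFamily P j).eval (z i) else if (j : ℕ) = N then 1 else 0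
  have h1 : M.det = vandermondeProd N z := by
    rw [vandermondeProd_eq_det_eval hP, Matrix.det_succ_row M (Fin.last N),
      Finset.sum_eq_single (Fin.last N)]
    · have h2 : M (Fin.last N) (Fin.last N) = 1 := by simp [M]
      rw [h2, ← two_mul, pow_mul]
      simp only [even_two, Even.neg_pow, one_pow, mul_one, one_mul, Fin.succAbove_last]
      congr 1
      ext i j
      have h3 : extendFamily P (j : ℕ) = P j := extendFamily_fin P j
      simp [M, h3]
    · intro j _ hj
      have h2 : M (Fin.last N) j = 0 := by
        have : (j : ℕ) ≠ N := fun h => hj (Fin.ext h)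
        simp [M, this]
      rw [h2]; ring
    · simp
  rw [← h1, ← Matrix.det_transpose, Matrix.det_apply']
  refine Finset.sum_congr rfl fun τ _ => ?_
  rw [mul_assoc]
  congr 1
  rw [Fin.prod_univ_castSucc, Finset.prod_range]
  congr 1
  · refine Finset.prod_congr rfl fun i _ => ?_
    have h3 : permVal τ (i : ℕ) = τ i.castSucc := permVal_fin τ i.castSucc
    rw [h3]
    simp [M]
  · have h3 : permVal τ N = τ (Fin.last N) := permVal_fin τ (Fin.last N)
    rw [h3]
    simp [M]

end Vandermonde

/-! ### The Pfaffian sum of a bordered matrix. -/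

section BorderedPfaffian

variable {j : ℕ}

/-- The first position of the `i`-th pair. -/
def pairFst (i : Fin j) : Fin (2 * j) := ⟨2 * (i : ℕ), by omega⟩

/-- The second position of the `i`-th pair. -/
def pairSnd (i : Fin j) : Fin (2 * j) := ⟨2 * (i : ℕ) + 1, by omega⟩

theorem pairFst_inj {i k : Fin j} : pairFst i = pairFst k ↔ i = k := by
  simp only [pairFst, Fin.ext_iff]; omega

theorem pairSnd_inj {i k : Fin j} : pairSnd i = pairSnd k ↔ i = k := by
  simp only [pairSnd, Fin.ext_iff]; omega

theorem pairFst_ne_pairSnd (i k : Fin j) : pairFst i ≠ pairSnd k := by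
  simp only [pairFst, pairSnd, ne_eq, Fin.ext_iff]; omega

/-- The permutation of the positions which exchanges two pairs. -/
def pairSwap (a b : Fin j) : Equiv.Perm (Fin (2 * j)) :=
  Equiv.swap (pairFst a) (pairFst b) * Equiv.swap (pairSnd a) (pairSnd b)

theorem sign_pairSwap (a b : Fin j) : Equiv.Perm.sign (pairSwap a b) = 1 := by
  rw [pairSwap, Equiv.Perm.sign_mul]
  by_cases h : a = b
  · subst h; simp
  · rw [Equiv.Perm.sign_swap (mt pairFst_inj.1 h), Equiv.Perm.sign_swap (mt pairSnd_inj.1 h)]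
    simp

theorem pairSwap_pairFst (a b i : Fin j) :
    pairSwap a b (pairFst i) = pairFst (Equiv.swap a b i) := by
  rw [pairSwap, Equiv.Perm.mul_apply, Equiv.swap_apply_of_ne_of_ne (pairFst_ne_pairSnd _ _)
    (pairFst_ne_pairSnd _ _)]
  simp only [Equiv.swap_apply_def, pairFst_inj]
  split_ifs <;> rfl

theorem pairSwap_pairSnd (a b i : Fin j) :
    pairSwap a b (pairSnd i) = pairSnd (Equiv.swap a b i) := by
  have h : Equiv.swap (pairSnd a) (pairSnd b) (pairSnd i) = pairSnd (Equiv.swap a b i) := by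
    simp only [Equiv.swap_apply_def, pairSnd_inj]
    split_ifs <;> rfl
  rw [pairSwap, Equiv.Perm.mul_apply, h, Equiv.swap_apply_of_ne_of_ne
    (pairFst_ne_pairSnd _ _).symm (pairFst_ne_pairSnd _ _).symm]

/-- A sum over the permutations in which one pair plays a special role does not depend on the
position of that pair. -/
theorem sum_perm_special_pair (u W : Fin (2 * j) → Fin (2 * j) → ℂ) (a b : Fin j) :
    ∑ τ : Equiv.Perm (Fin (2 * j)), ((Equiv.Perm.sign τ : ℤ) : ℂ) *
      (W (τ (pairFst a)) (τ (pairSnd a)) *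
        ∏ i ∈ Finset.univ.erase a, u (τ (pairFst i)) (τ (pairSnd i))) =
    ∑ τ : Equiv.Perm (Fin (2 * j)), ((Equiv.Perm.sign τ : ℤ) : ℂ) *
      (W (τ (pairFst b)) (τ (pairSnd b)) *
        ∏ i ∈ Finset.univ.erase b, u (τ (pairFst i)) (τ (pairSnd i))) := by
  -- `pairSwap` is even, so this substitution moves the special pair without a sign.
  rw [← Equiv.sum_comp (Equiv.mulRight (pairSwap a b))]
  refine Finset.sum_congr rfl fun τ _ => ?_
  simp only [Equiv.coe_mulRight, Equiv.Perm.sign_mul, sign_pairSwap, mul_one,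
    Equiv.Perm.mul_apply, pairSwap_pairFst, pairSwap_pairSnd, Equiv.swap_apply_left]
  congr 2
  refine Finset.prod_nbij (Equiv.swap a b) ?_ (Equiv.swap a b).injective.injOn ?_ fun _ _ => rfl
  · intro i hi
    have : i ≠ a := by simpa using hi
    simp only [Finset.mem_erase, Finset.mem_univ, and_true]
    exact fun h => this ((Equiv.swap a b).injective (h.trans (Equiv.swap_apply_left a b).symm))
  · intro i hi
    have hib : i ≠ b := by simpa using hi
    refine ⟨Equiv.swap a b i, ?_, Equiv.swap_apply_self a b i⟩
    simp only [Finset.coe_erase, Finset.coe_univ, Set.mem_sdiff, Set.mem_univ, true_and,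
      Set.mem_singleton_iff]
    exact fun h => hib ((Equiv.swap a b).injective (h.trans (Equiv.swap_apply_right a b).symm))

/-- Exchanging the two positions of a pair changes the sign. -/
theorem sum_perm_swap_pair (u A : Fin (2 * j) → Fin (2 * j) → ℂ) (a : Fin j) :
    ∑ τ : Equiv.Perm (Fin (2 * j)), ((Equiv.Perm.sign τ : ℤ) : ℂ) *
      (A (τ (pairSnd a)) (τ (pairFst a)) *
        ∏ i ∈ Finset.univ.erase a, u (τ (pairFst i)) (τ (pairSnd i))) =
    -∑ τ : Equiv.Perm (Fin (2 * j)), ((Equiv.Perm.sign τ : ℤ) : ℂ) *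
      (A (τ (pairFst a)) (τ (pairSnd a)) *
        ∏ i ∈ Finset.univ.erase a, u (τ (pairFst i)) (τ (pairSnd i))) := by
  rw [← Equiv.sum_comp (Equiv.mulRight (Equiv.swap (pairFst a) (pairSnd a))),
    ← Finset.sum_neg_distrib]
  refine Finset.sum_congr rfl fun τ _ => ?_
  simp only [Equiv.coe_mulRight, Equiv.Perm.sign_mul, Equiv.Perm.mul_apply,
    Equiv.Perm.sign_swap (pairFst_ne_pairSnd a a), Equiv.swap_apply_left, Equiv.swap_apply_right]
  have h : ∏ i ∈ Finset.univ.erase a,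
      u (τ (Equiv.swap (pairFst a) (pairSnd a) (pairFst i)))
        (τ (Equiv.swap (pairFst a) (pairSnd a) (pairSnd i))) =
      ∏ i ∈ Finset.univ.erase a, u (τ (pairFst i)) (τ (pairSnd i)) := by
    refine Finset.prod_congr rfl fun i hi => ?_
    have hia : i ≠ a := by simpa using hi
    rw [Equiv.swap_apply_of_ne_of_ne (mt pairFst_inj.1 hia) (pairFst_ne_pairSnd _ _),
      Equiv.swap_apply_of_ne_of_ne (pairFst_ne_pairSnd _ _).symm (mt pairSnd_inj.1 hia)]
  rw [h]
  push_cast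
  ring

theorem exists_pair_eq (p : Fin (2 * j)) : ∃ i : Fin j, p = pairFst i ∨ p = pairSnd i := by
  refine ⟨⟨p / 2, by omega⟩, ?_⟩
  simp only [pairFst, pairSnd, Fin.ext_iff]
  omega

/-- The Pfaffian sum of `u + A - Aᵀ`, where `u` vanishes on the row and the column `l` and `A` is
supported on the column `l`. -/
theorem sum_perm_bordered (u A : Fin (2 * j) → Fin (2 * j) → ℂ) (l : Fin (2 * j))
    (hu : ∀ k, u l k = 0 ∧ u k l = 0) (hA : ∀ a b, b ≠ l → A a b = 0) (c : Fin j) :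
    ∑ τ : Equiv.Perm (Fin (2 * j)), ((Equiv.Perm.sign τ : ℤ) : ℂ) *
      ∏ i : Fin j, (u (τ (pairFst i)) (τ (pairSnd i)) +
        (A (τ (pairFst i)) (τ (pairSnd i)) - A (τ (pairSnd i)) (τ (pairFst i)))) =
    2 * j * ∑ τ : Equiv.Perm (Fin (2 * j)), ((Equiv.Perm.sign τ : ℤ) : ℂ) *
      (A (τ (pairFst c)) (τ (pairSnd c)) *
        ∏ i ∈ Finset.univ.erase c, u (τ (pairFst i)) (τ (pairSnd i))) := by
  -- Exactly one pair contains `l`. There `u` vanishes, and at all other pairs `A` vanishes, so only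
  -- one term of the expanded product survives. It is written as a sum over all pairs so that the
  -- two summations can be exchanged.
  have hexp : ∀ τ : Equiv.Perm (Fin (2 * j)),
      ∏ i : Fin j, (u (τ (pairFst i)) (τ (pairSnd i)) +
        (A (τ (pairFst i)) (τ (pairSnd i)) - A (τ (pairSnd i)) (τ (pairFst i)))) =
      ∑ k : Fin j, (A (τ (pairFst k)) (τ (pairSnd k)) - A (τ (pairSnd k)) (τ (pairFst k))) *
        ∏ i ∈ Finset.univ.erase k, u (τ (pairFst i)) (τ (pairSnd i)) := by
    intro τ
    obtain ⟨k, hk⟩ := exists_pair_eq (τ.symm l)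
    have hk' : τ (pairFst k) = l ∨ τ (pairSnd k) = l := by
      rcases hk with h | h
      · left; rw [← h, Equiv.apply_symm_apply]
      · right; rw [← h, Equiv.apply_symm_apply]
    have huk : u (τ (pairFst k)) (τ (pairSnd k)) = 0 := by
      rcases hk' with h | h
      · rw [h]; exact (hu _).1
      · rw [h]; exact (hu _).2
    have hAk : ∀ i, i ≠ k →
        A (τ (pairFst i)) (τ (pairSnd i)) = 0 ∧ A (τ (pairSnd i)) (τ (pairFst i)) = 0 := by
      intro i hi
      constructor
      · refine hA _ _ fun h => ?_
        have h2 : pairSnd i = τ.symm l := by rw [← h, Equiv.symm_apply_apply]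
        rcases hk with h3 | h3
        · exact pairFst_ne_pairSnd k i (h3.symm.trans h2.symm)
        · exact hi (pairSnd_inj.1 (h2.trans h3))
      · refine hA _ _ fun h => ?_
        have h2 : pairFst i = τ.symm l := by rw [← h, Equiv.symm_apply_apply]
        rcases hk with h3 | h3
        · exact hi (pairFst_inj.1 (h2.trans h3))
        · exact pairFst_ne_pairSnd i k (h2.trans h3)
    rw [Finset.sum_eq_single k, ← Finset.mul_prod_erase _ _ (Finset.mem_univ k), huk, zero_add]
    · congr 1
      refine Finset.prod_congr rfl fun i hi => ?_
      have hik : i ≠ k := by simpa using hi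
      rw [(hAk i hik).1, (hAk i hik).2, sub_zero, add_zero]
    · intro i _ hi
      rw [(hAk i hi).1, (hAk i hi).2, sub_zero, zero_mul]
    · simp
  simp_rw [hexp, Finset.mul_sum]
  rw [Finset.sum_comm]
  -- The `2` comes from the two orders within the special pair; summing over its `j` positions gives
  -- the factor `2 * j`.
  have hk : ∀ k : Fin j, ∑ τ : Equiv.Perm (Fin (2 * j)), ((Equiv.Perm.sign τ : ℤ) : ℂ) *
      ((A (τ (pairFst k)) (τ (pairSnd k)) - A (τ (pairSnd k)) (τ (pairFst k))) *
        ∏ i ∈ Finset.univ.erase k, u (τ (pairFst i)) (τ (pairSnd i))) =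
      2 * ∑ τ : Equiv.Perm (Fin (2 * j)), ((Equiv.Perm.sign τ : ℤ) : ℂ) *
      (A (τ (pairFst c)) (τ (pairSnd c)) *
        ∏ i ∈ Finset.univ.erase c, u (τ (pairFst i)) (τ (pairSnd i))) := by
    intro k
    simp_rw [sub_mul, mul_sub]
    rw [Finset.sum_sub_distrib, sum_perm_swap_pair u A k, sum_perm_special_pair u A k c]
    ring
  rw [Finset.sum_congr rfl fun k _ => hk k, Finset.sum_const, Finset.card_univ, Fintype.card_fin,
    nsmul_eq_mul, Finset.mul_sum, Finset.mul_sum]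
  refine Finset.sum_congr rfl fun τ _ => ?_
  ring

end BorderedPfaffian

/-! ### Induction on the degree, from point moments to sums over permutations. -/

section Induction

variable {Φ : ℂ[X] → ℝ} {s : ℂ} {N K : ℕ} {P : Fin N → ℂ[X]}

theorem extendFamily_natDegree_lt (hP : IsCompleteMonicFamily P) (hN : 0 < N) (k : ℕ) :
    (extendFamily P k).natDegree + 1 ≤ N := by
  rw [extendFamily]
  split_ifs with h
  · rw [(hP _).2]; exact h
  · rw [natDegree_zero]; omega

/-- The part of the summand of `τ` in a Pfaffian sum which belongs to the pairs of positions from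
`m` on. -/
def pairFactor (Φ : ℂ[X] → ℝ) (s : ℂ) (P : Fin N → ℂ[X]) (τ : Equiv.Perm (Fin K)) (j m : ℕ) : ℂ :=
  ∏ i ∈ Finset.range j, skewForm Φ s (extendFamily P (permVal τ (m + 2 * i)))
    (extendFamily P (permVal τ (m + 2 * i + 1)))

/-- The part of the summand of `τ` which belongs to the points at the positions before `m`. -/
def pointFactor (P : Fin N → ℂ[X]) (τ : Equiv.Perm (Fin K)) (m : ℕ) (z : ℕ → ℂ) : ℂ :=
  ∏ i ∈ Finset.range m, (extendFamily P (permVal τ i)).eval (z i)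

/-- The alternating sum of products of point values, skew products and a factor `E`. -/
def mixedSum (Φ : ℂ[X] → ℝ) (s : ℂ) (P : Fin N → ℂ[X]) (E : Equiv.Perm (Fin K) → ℂ) (j m : ℕ)
    (z : ℕ → ℂ) : ℂ :=
  ∑ τ : Equiv.Perm (Fin K), ((Equiv.Perm.sign τ : ℤ) : ℂ) * pointFactor P τ m z *
    pairFactor Φ s P τ j m * E τ

theorem pairFactor_succ (τ : Equiv.Perm (Fin K)) (j m : ℕ) :
    pairFactor Φ s P τ (j + 1) m = skewForm Φ s (extendFamily P (permVal τ m))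
      (extendFamily P (permVal τ (m + 1))) * pairFactor Φ s P τ j (m + 2) := by
  rw [pairFactor, Finset.prod_range_succ', mul_comm, pairFactor]
  congr 1
  refine Finset.prod_congr rfl fun i _ => ?_
  rw [show m + 2 * (i + 1) = m + 2 + 2 * i by ring]

theorem pointFactor_updateTwo (τ : Equiv.Perm (Fin K)) (m : ℕ) (z : ℕ → ℂ) (a b : ℂ) :
    pointFactor P τ (m + 2) (updateTwo z m a b) = pointFactor P τ m z *
      (extendFamily P (permVal τ m)).eval a * (extendFamily P (permVal τ (m + 1))).eval b := by
  rw [pointFactor, Finset.prod_range_succ, Finset.prod_range_succ, updateTwo_self, updateTwo_succ,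
    pointFactor]
  congr 2
  refine Finset.prod_congr rfl fun i hi => ?_
  rw [updateTwo_of_lt (Finset.mem_range.1 hi)]

theorem momentWeight_X_sub_C (m : ℕ) (z : ℕ → ℂ) (a : ℂ) :
    momentWeight Φ s m z (X - C a) = rootWeight Φ s a * ∏ i ∈ Finset.range m, (z i - a) := by
  simp [momentWeight, rootWeight_eq_polyWeight]

theorem abs_eq_sign_mul (x : ℝ) : |x| = Real.sign x * x := by
  rcases lt_trichotomy x 0 with h | h | h
  · rw [abs_of_neg h, Real.sign_of_neg h]; ring
  · simp [h]
  · rw [abs_of_pos h, Real.sign_of_pos h, one_mul]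

/-- This is why the point moment is multiplied by a Vandermonde product: the values of `(X - a)(X -
b)` at the points, times `b - a`, are exactly the factors missing for the two additional points. -/
theorem vandermondeProd_mul_momentWeight_mul (m : ℕ) (z : ℕ → ℂ) (a b : ℂ) :
    vandermondeProd m z * ((b - a) *
      (momentWeight Φ s m z (X - C a) * momentWeight Φ s m z (X - C b))) =
    rootWeight Φ s a * rootWeight Φ s b * vandermondeProd (m + 2) (updateTwo z m a b) := by
  rw [momentWeight_X_sub_C, momentWeight_X_sub_C, vandermondeProd_updateTwo]
  ring

/-- The induction step: one real quadratic factor gives one skew product. -/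
theorem IsMultiplicativeDistance.vandermondeProd_mul_pointMoment_add_two
    (hΦ : IsMultiplicativeDistance Φ) (hP : IsCompleteMonicFamily P) (hs : (N : ℝ) < s.re)
    {E : Equiv.Perm (Fin K) → ℂ} {n m j : ℕ} (hn : 2 + n + m = N) {c : ℂ}
    (ih : ∀ z, vandermondeProd (m + 2) z * pointMoment Φ s n (m + 2) z =
      c * mixedSum Φ s P E j (m + 2) z) (z : ℕ → ℂ) :
    ((2 * ((2 + n) / 2) : ℕ) : ℂ) * (vandermondeProd m z * pointMoment Φ s (2 + n) m z) =
      c * mixedSum Φ s P E (j + 1) m z := by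
  have hdeg : ∀ k, ((extendFamily P k).natDegree : ℝ) + 1 < s.re := fun k => by
    have h1 := extendFamily_natDegree_lt hP (by omega) k
    have h2 : ((extendFamily P k).natDegree : ℝ) + 1 ≤ N := by exact_mod_cast h1
    linarith
  -- All factors of the summand of `τ` that do not involve the two new points; the rest integrates
  -- to one skew product.
  let coef : Equiv.Perm (Fin K) → ℂ := fun τ => c * (((Equiv.Perm.sign τ : ℤ) : ℂ) *
    pointFactor P τ m z * pairFactor Φ s P τ j (m + 2) * E τ)
  have hmix : ∀ a b, c * mixedSum Φ s P E j (m + 2) (updateTwo z m a b) =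
      ∑ τ, coef τ * ((extendFamily P (permVal τ m)).eval a *
        (extendFamily P (permVal τ (m + 1))).eval b) := by
    intro a b
    rw [mixedSum, Finset.mul_sum]
    refine Finset.sum_congr rfl fun τ _ => ?_
    rw [pointFactor_updateTwo]
    ring
  rw [mul_left_comm, hΦ.pointMoment_add_two (hn ▸ hs), mul_add, ← integral_const_mul,
    ← integral_const_mul]
  have hR : ∀ v : ℝ × ℝ, vandermondeProd m z * ((|v.2 - v.1| : ℝ) *
        (momentWeight Φ s m z (X - C (v.1 : ℂ)) * momentWeight Φ s m z (X - C (v.2 : ℂ))) *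
          pointMoment Φ s n (m + 2) (updateTwo z m v.1 v.2)) =
      ∑ τ, coef τ * realFormIntegrand Φ s (extendFamily P (permVal τ m))
        (extendFamily P (permVal τ (m + 1))) v := by
    intro v
    have h1 := vandermondeProd_mul_momentWeight_mul (Φ := Φ) (s := s) m z v.1 v.2
    have h2 := ih (updateTwo z m v.1 v.2)
    rw [hmix] at h2
    have h3 : ∑ τ, coef τ * realFormIntegrand Φ s (extendFamily P (permVal τ m))
        (extendFamily P (permVal τ (m + 1))) v =
        rootWeight Φ s v.1 * rootWeight Φ s v.2 * (Real.sign (v.2 - v.1) : ℂ) *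
        ∑ τ, coef τ * ((extendFamily P (permVal τ m)).eval (v.1 : ℂ) *
        (extendFamily P (permVal τ (m + 1))).eval (v.2 : ℂ)) := by
      rw [Finset.mul_sum]
      refine Finset.sum_congr rfl fun τ _ => ?_
      rw [realFormIntegrand]; ring
    rw [h3, ← h2, abs_eq_sign_mul]
    push_cast
    linear_combination ((Real.sign (v.2 - v.1) : ℂ) *
      pointMoment Φ s n (m + 2) (updateTwo z m v.1 v.2)) * h1
  have hC : ∀ β : ℂ, vandermondeProd m z * ((4 * |β.im| : ℝ) *
        (momentWeight Φ s m z (X - C (starRingEnd ℂ β)) * momentWeight Φ s m z (X - C β)) *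
          pointMoment Φ s n (m + 2) (updateTwo z m (starRingEnd ℂ β) β)) =
      ∑ τ, coef τ * (-2 * Complex.I * complexFormIntegrand Φ s (extendFamily P (permVal τ m))
        (extendFamily P (permVal τ (m + 1))) β) := by
    intro β
    have h1 := vandermondeProd_mul_momentWeight_mul (Φ := Φ) (s := s) m z (starRingEnd ℂ β) β
    have h2 := ih (updateTwo z m (starRingEnd ℂ β) β)
    rw [hmix] at h2
    have h3 : ∑ τ, coef τ * (-2 * Complex.I * complexFormIntegrand Φ s
        (extendFamily P (permVal τ m)) (extendFamily P (permVal τ (m + 1))) β) =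
        -2 * Complex.I * rootWeight Φ s (starRingEnd ℂ β) * rootWeight Φ s β *
          (Real.sign β.im : ℂ) *
        ∑ τ, coef τ * ((extendFamily P (permVal τ m)).eval (starRingEnd ℂ β) *
        (extendFamily P (permVal τ (m + 1))).eval β) := by
      rw [Finset.mul_sum]
      refine Finset.sum_congr rfl fun τ _ => ?_
      rw [complexFormIntegrand]; ring
    -- Hence `4 |Im β| = -2i sgn(Im β) (β - β̄)`, the source of the constant in `complexForm`.
    have h4 : β - starRingEnd ℂ β = 2 * β.im * Complex.I := by
      rw [Complex.sub_conj]; push_cast; ring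
    rw [h4] at h1
    rw [h3, ← h2, abs_eq_sign_mul]
    push_cast
    linear_combination (-2 * Complex.I * (Real.sign β.im : ℂ) *
      pointMoment Φ s n (m + 2) (updateTwo z m (starRingEnd ℂ β) β)) * h1 +
      (4 * (Real.sign β.im : ℂ) * β.im * vandermondeProd m z *
        momentWeight Φ s m z (X - C (starRingEnd ℂ β)) * momentWeight Φ s m z (X - C β) *
        pointMoment Φ s n (m + 2) (updateTwo z m (starRingEnd ℂ β) β)) * Complex.I_sq
  simp_rw [hR, hC]
  rw [integral_finsetSum _ fun τ _ => (hΦ.integrable_realForm (hdeg _) (hdeg _)).const_mul _,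
    integral_finsetSum _ fun τ _ =>
      ((hΦ.integrable_complexForm (hdeg _) (hdeg _)).const_mul _).const_mul _,
    ← Finset.sum_add_distrib, mixedSum, Finset.mul_sum]
  refine Finset.sum_congr rfl fun τ _ => ?_
  rw [integral_const_mul, integral_const_mul, integral_const_mul, pairFactor_succ, skewForm,
    realForm, complexForm]
  simp only [coef]
  ring

/-- Here `r` is the degree left after all quadratic factors are removed, and `E` carries the
contribution of that remainder. Because `r < 2`, the step to `j + 1` divides by `2 (j + 1)`, and
these divisors accumulate to `2^j j!`. -/
theorem IsMultiplicativeDistance.vandermondeProd_mul_pointMoment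
    (hΦ : IsMultiplicativeDistance Φ) (hP : IsCompleteMonicFamily P) (hs : (N : ℝ) < s.re)
    {E : Equiv.Perm (Fin K) → ℂ} {r : ℕ} (hr : r < 2)
    (base : ∀ m z, r + m = N →
      vandermondeProd m z * pointMoment Φ s r m z = mixedSum Φ s P E 0 m z) (j : ℕ) :
    ∀ m z, 2 * j + r + m = N → vandermondeProd m z * pointMoment Φ s (2 * j + r) m z =
      1 / (2 ^ j * (j.factorial : ℂ)) * mixedSum Φ s P E j m z := by
  induction j with
  | zero =>
    intro m z h
    rw [mul_zero, zero_add, base m z (by omega)]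
    simp
  | succ j ih =>
    intro m z h
    have h1 := hΦ.vandermondeProd_mul_pointMoment_add_two hP hs (E := E) (n := 2 * j + r) (m := m)
      (by omega) (fun z => ih (m + 2) z (by omega)) z
    rw [show (2 + (2 * j + r)) / 2 = j + 1 by omega] at h1
    rw [show 2 * (j + 1) + r = 2 + (2 * j + r) by ring]
    have h2 : (2 ^ j : ℂ) ≠ 0 := pow_ne_zero _ two_ne_zero
    have h3 : (j.factorial : ℂ) ≠ 0 := by exact_mod_cast j.factorial_ne_zero
    have h4 : ((j : ℂ) + 1) ≠ 0 := by exact_mod_cast j.succ_ne_zero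
    rw [Nat.factorial_succ]
    push_cast at h1 ⊢
    field_simp at h1 ⊢
    rw [pow_succ]
    linear_combination h1

theorem IsMultiplicativeDistance.pointMoment_zero (hΦ : IsMultiplicativeDistance Φ) (m : ℕ)
    (z : ℕ → ℂ) : pointMoment Φ s 0 m z = 1 := by
  have h : ∀ b : Fin 0 → ℝ, (monicPoly b).map Complex.ofRealHom = 1 := fun b => by
    simp [monicPoly, lowPoly]
  simp only [pointMoment, h]
  simp [momentWeight, hΦ.polyWeight_one, Measure.real, volume_pi, Measure.pi_empty_univ]

theorem IsMultiplicativeDistance.vandermondeProd_mul_pointMoment_zero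
    (hΦ : IsMultiplicativeDistance Φ) (hP : IsCompleteMonicFamily P) (hK : K = N) (m : ℕ)
    (z : ℕ → ℂ) (hm : 0 + m = N) : vandermondeProd m z * pointMoment Φ s 0 m z =
      mixedSum Φ s P (fun _ : Equiv.Perm (Fin K) => 1) 0 m z := by
  subst hK
  obtain rfl : m = K := by omega
  rw [hΦ.pointMoment_zero, mul_one, vandermondeProd_eq_sum hP, mixedSum]
  simp [pairFactor, pointFactor]

theorem pointMoment_one (m : ℕ) (z : ℕ → ℂ) : pointMoment Φ s 1 m z =
    ∫ x : ℝ, rootWeight Φ s x * ∏ i ∈ Finset.range m, (z i - x) := by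
  -- Reflection turns the coefficient of `X + b` into the root of `X - x`.
  rw [pointMoment, ← integral_neg_eq_self, ← (volume_preserving_funUnique (Fin 1) ℝ).integral_comp
    (MeasurableEquiv.funUnique (Fin 1) ℝ).measurableEmbedding]
  refine integral_congr_ae (Filter.Eventually.of_forall fun b => ?_)
  dsimp only
  have h : (monicPoly (-b)).map Complex.ofRealHom =
      X - C ((MeasurableEquiv.funUnique (Fin 1) ℝ b : ℝ) : ℂ) := by
    have h1 : -b = fun _ => -(MeasurableEquiv.funUnique (Fin 1) ℝ b) := by
      ext i; rw [Subsingleton.elim i default]; rfl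
    rw [h1, monicPoly_linear]
    simp
  rw [h, momentWeight_X_sub_C]

/-- The factor of the summand of `τ` which belongs to the real linear factor. -/
def borderFactor (Φ : ℂ[X] → ℝ) (s : ℂ) (P : Fin N → ℂ[X]) (τ : Equiv.Perm (Fin K)) : ℂ :=
  (if permVal τ N = N then 1 else 0) *
    ∫ x : ℝ, borderIntegrand Φ s (extendFamily P (permVal τ (N - 1))) x

/-- The values of the linear factor `X - x` at the points extend their Vandermonde product by `x`.
The reversal of the differences costs `(-1)^m`, which is `1` because `m = N - 1` is even. -/
theorem IsMultiplicativeDistance.vandermondeProd_mul_pointMoment_one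
    (hΦ : IsMultiplicativeDistance Φ) (hP : IsCompleteMonicFamily P) (hs : (N : ℝ) < s.re)
    (hN : Odd N) (hK : K = N + 1) (m : ℕ)
    (z : ℕ → ℂ) (hm : 1 + m = N) : vandermondeProd m z * pointMoment Φ s 1 m z =
      mixedSum Φ s P (borderFactor Φ s P : Equiv.Perm (Fin K) → ℂ) 0 m z := by
  subst hK
  have hdeg : ∀ k, ((extendFamily P k).natDegree : ℝ) + 1 < s.re := fun k => by
    have h1 := extendFamily_natDegree_lt hP (by omega) k
    have h2 : ((extendFamily P k).natDegree : ℝ) + 1 ≤ N := by exact_mod_cast h1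
    linarith
  obtain rfl : N = m + 1 := by omega
  have heven : Even m := by
    rw [Nat.odd_add_one, Nat.not_odd_iff_even] at hN; exact hN
  let coef : Equiv.Perm (Fin (m + 1 + 1)) → ℂ := fun τ => ((Equiv.Perm.sign τ : ℤ) : ℂ) *
    pointFactor P τ m z * (if permVal τ (m + 1) = m + 1 then 1 else 0)
  have hx : ∀ x : ℝ, vandermondeProd m z *
      (rootWeight Φ s x * ∏ i ∈ Finset.range m, (z i - x)) =
      ∑ τ, coef τ * borderIntegrand Φ s (extendFamily P (permVal τ m)) x := by
    intro x
    have h1 := vandermondeProd_update m z x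
    rw [vandermondeProd_eq_sum_bordered hP] at h1
    have h2 : ∏ i ∈ Finset.range m, ((x : ℂ) - z i) = ∏ i ∈ Finset.range m, (z i - x) := by
      rw [Finset.prod_congr rfl fun i _ => show (x : ℂ) - z i = -1 * (z i - x) by ring,
        Finset.prod_mul_distrib, Finset.prod_const, Finset.card_range, heven.neg_one_pow, one_mul]
    rw [h2] at h1
    rw [mul_left_comm, ← h1, Finset.mul_sum]
    refine Finset.sum_congr rfl fun τ _ => ?_
    rw [Finset.prod_range_succ, Function.update_self]
    have h3 : ∏ i ∈ Finset.range m, (extendFamily P (permVal τ i)).eval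
        (Function.update z m (x : ℂ) i) = pointFactor P τ m z :=
      Finset.prod_congr rfl fun i hi => by
        rw [Function.update_of_ne (Finset.mem_range.1 hi).ne]
    rw [h3, borderIntegrand]
    simp only [coef]
    ring
  rw [pointMoment_one, ← integral_const_mul]
  simp_rw [hx]
  rw [integral_finsetSum _ fun τ _ => (hΦ.integrable_border (hdeg _)).const_mul _, mixedSum]
  refine Finset.sum_congr rfl fun τ _ => ?_
  rw [integral_const_mul, borderFactor, Nat.add_sub_cancel]
  simp only [coef, pairFactor, Finset.range_zero, Finset.prod_empty]
  ring

end Induction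

/-! ### Antisymmetry of the forms and of the matrix. -/

section Antisymmetry

variable {Φ : ℂ[X] → ℝ} {s : ℂ}

theorem real_sign_neg (x : ℝ) : Real.sign (-x) = -Real.sign x := by
  rcases lt_trichotomy x 0 with h | h | h
  · rw [Real.sign_of_neg h, Real.sign_of_pos (neg_pos.2 h), neg_neg]
  · simp [h]
  · rw [Real.sign_of_pos h, Real.sign_of_neg (neg_neg_of_pos h)]

theorem realForm_swap (P Q : ℂ[X]) : realForm Φ s P Q = -realForm Φ s Q P := by
  rw [realForm, realForm, ← integral_neg]
  have h := (Measure.measurePreserving_swap (μ := (volume : Measure ℝ))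
    (ν := (volume : Measure ℝ))).integral_comp MeasurableEquiv.prodComm.measurableEmbedding
    (realFormIntegrand Φ s P Q)
  refine h.symm.trans (integral_congr_ae (Filter.Eventually.of_forall fun z => ?_))
  simp only [realFormIntegrand, Prod.fst_swap, Prod.snd_swap]
  rw [← neg_sub z.2 z.1, real_sign_neg]
  push_cast
  ring

theorem complexForm_swap (P Q : ℂ[X]) : complexForm Φ s P Q = -complexForm Φ s Q P := by
  rw [complexForm, complexForm, ← mul_neg, ← integral_neg]
  congr 1
  have h := Complex.conjLIE.measurePreserving.integral_comp
    Complex.conjLIE.toHomeomorph.measurableEmbedding (complexFormIntegrand Φ s P Q)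
  refine h.symm.trans (integral_congr_ae (Filter.Eventually.of_forall fun β => ?_))
  simp only [complexFormIntegrand, Complex.conjLIE_apply, Complex.conj_conj, Complex.conj_im]
  rw [real_sign_neg]
  push_cast
  ring

theorem skewForm_swap (P Q : ℂ[X]) : skewForm Φ s P Q = -skewForm Φ s Q P := by
  rw [skewForm, realForm_swap, complexForm_swap, skewForm]
  ring

theorem skewForm_zero_left (Q : ℂ[X]) : skewForm Φ s 0 Q = 0 := by
  simp [skewForm, realForm, complexForm, realFormIntegrand, complexFormIntegrand]

theorem skewForm_zero_right (P : ℂ[X]) : skewForm Φ s P 0 = 0 := by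
  rw [skewForm_swap, skewForm_zero_left, neg_zero]

theorem skewMatrix_transpose {N : ℕ} (P : Fin N → ℂ[X]) :
    (skewMatrix Φ s P).transpose = -skewMatrix Φ s P := by
  ext j k
  simp only [skewMatrix, Matrix.transpose_apply, Matrix.of_apply, Matrix.neg_apply]
  by_cases h : (j : ℕ) < N ∧ (k : ℕ) < N
  · rw [dif_pos h, dif_pos h.symm]
    exact skewForm_swap _ _
  · rw [dif_neg h, dif_neg fun h' => h h'.symm]
    by_cases h' : min (j : ℕ) (k : ℕ) < N
    · have h'' : min (k : ℕ) (j : ℕ) < N := by rwa [min_comm]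
      rw [dif_pos h', dif_pos h'', ← neg_sub (k : ℤ) (j : ℤ), Left.sign_neg]
      simp only [min_comm (k : ℕ) (j : ℕ)]
      simp
    · have h'' : ¬ min (k : ℕ) (j : ℕ) < N := by rwa [min_comm]
      rw [dif_neg h', dif_neg h'', neg_zero]

/-- The matrix `skewMatrix` in terms of the extended family. -/
theorem skewMatrix_apply_eq {N : ℕ} (P : Fin N → ℂ[X]) (a b : Fin (2 * ((N + 1) / 2))) :
    skewMatrix Φ s P a b = skewForm Φ s (extendFamily P a) (extendFamily P b) +
      ((if (b : ℕ) = N then ∫ x : ℝ, borderIntegrand Φ s (extendFamily P a) x else 0) -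
        if (a : ℕ) = N then ∫ x : ℝ, borderIntegrand Φ s (extendFamily P b) x else 0) := by
  have ha := a.2
  have hb := b.2
  have hN : extendFamily P N = 0 := by simp [extendFamily]
  simp only [skewMatrix, Matrix.of_apply]
  by_cases h : (a : ℕ) < N ∧ (b : ℕ) < N
  · rw [dif_pos h, if_neg h.2.ne, if_neg h.1.ne, sub_zero, add_zero, extendFamily, extendFamily,
      dif_pos h.1, dif_pos h.2]
  · rw [dif_neg h]
    rcases lt_or_ge (a : ℕ) N with h1 | h1
    · have h2 : (b : ℕ) = N := by omega
      have h3 : min (a : ℕ) (b : ℕ) = a := by omega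
      have h4 : (0 : ℤ) < (b : ℤ) - (a : ℤ) := by omega
      have hb0 : extendFamily P (b : ℕ) = 0 := by rw [h2, hN]
      rw [dif_pos (by omega), if_pos h2, if_neg h1.ne, hb0, skewForm_zero_right, zero_add,
        sub_zero, sign_pos h4, extendFamily, dif_pos h1]
      simp only [h3]
      simp
    · have h2 : (a : ℕ) = N := by omega
      rcases lt_or_ge (b : ℕ) N with h5 | h5
      · have h3 : min (a : ℕ) (b : ℕ) = b := by omega
        have h4 : (b : ℤ) - (a : ℤ) < 0 := by omega
        have ha0 : extendFamily P (a : ℕ) = 0 := by rw [h2, hN]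
        rw [dif_pos (by omega), if_pos h2, if_neg h5.ne, ha0, skewForm_zero_left, zero_add,
          zero_sub, sign_neg h4, extendFamily, dif_pos h5]
        simp only [h3]
        simp
      · have h6 : (b : ℕ) = N := by omega
        rw [dif_neg (by omega), h2, h6, hN, skewForm_zero_left]
        simp

end Antisymmetry

/-! ### Identification with the Pfaffian for even and odd `N`. -/

section Conclusion

variable {Φ : ℂ[X] → ℝ} {s : ℂ} {N : ℕ} {P : Fin N → ℂ[X]}

/-- The theorem lists coefficients from the top degree down and `monicPoly` from the bottom up; the
reversal of coordinates preserves Lebesgue measure. -/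
theorem monicRestriction_eq (b : Fin N → ℝ) :
    monicRestriction Φ N (fun i => (b i : ℂ)) =
      Φ ((monicPoly fun i => b (Fin.rev i)).map Complex.ofRealHom) := by
  have h : ∑ i : Fin N, C (b i : ℂ) * X ^ (N - ((i : ℕ) + 1)) =
      ∑ i : Fin N, C (Complex.ofRealHom (b (Fin.rev i))) * X ^ (i : ℕ) := by
    refine (Equiv.sum_comp Fin.revPerm
      (fun i : Fin N => C (b i : ℂ) * X ^ (N - ((i : ℕ) + 1)))).symm.trans ?_
    refine Finset.sum_congr rfl fun i _ => ?_
    have hi : N - ((Fin.rev i : ℕ) + 1) = i := by rw [Fin.val_rev]; omega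
    rw [Fin.revPerm_apply, hi, Complex.ofRealHom_eq_coe]
  rw [monicRestriction, monicPoly_map, monicPoly, lowPoly, h]

theorem measurePreserving_rev :
    MeasurePreserving (MeasurableEquiv.piCongrLeft (fun _ : Fin N => ℝ) Fin.revPerm)
      volume volume :=
  volume_measurePreserving_piCongrLeft _ _

theorem momentIntegrand_eq (z : ℕ → ℂ) : momentIntegrand Φ N s =
    (fun b : Fin N → ℝ => momentWeight Φ s 0 z ((monicPoly b).map Complex.ofRealHom)) ∘
      MeasurableEquiv.piCongrLeft (fun _ : Fin N => ℝ) Fin.revPerm := by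
  ext b
  have h : MeasurableEquiv.piCongrLeft (fun _ : Fin N => ℝ) Fin.revPerm b =
      fun i => b (Fin.rev i) := by
    ext i
    obtain ⟨i, rfl⟩ := Fin.revPerm.surjective i
    rw [MeasurableEquiv.coe_piCongrLeft, Fin.revPerm_apply, Fin.rev_rev]
    exact Equiv.piCongrLeft_apply_apply (P := fun _ => ℝ) Fin.revPerm b i
  simp only [momentIntegrand, Function.comp_apply, monicRestriction_eq, momentWeight, polyWeight,
    Finset.range_zero, Finset.prod_empty, mul_one]
  rw [h]

theorem IsMultiplicativeDistance.integrable_momentIntegrand (hΦ : IsMultiplicativeDistance Φ)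
    (hs : (N : ℝ) < s.re) : Integrable (momentIntegrand Φ N s) := by
  rw [momentIntegrand_eq 0, measurePreserving_rev.integrable_comp_emb
    (MeasurableEquiv.measurableEmbedding _)]
  exact hΦ.integrable_momentWeight (by simpa using hs) 0

theorem realMoment_eq_pointMoment (z : ℕ → ℂ) : realMoment Φ N s = pointMoment Φ s N 0 z := by
  rw [realMoment, momentIntegrand_eq z]
  exact measurePreserving_rev.integral_comp (MeasurableEquiv.measurableEmbedding _)
    fun b : Fin N → ℝ => momentWeight Φ s 0 z ((monicPoly b).map Complex.ofRealHom)

theorem pairFactor_zero_eq {J : ℕ} (τ : Equiv.Perm (Fin (2 * J))) :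
    pairFactor Φ s P τ J 0 = ∏ i : Fin J, skewForm Φ s (extendFamily P (τ (pairFst i)))
      (extendFamily P (τ (pairSnd i))) := by
  rw [pairFactor, Finset.prod_range]
  refine Finset.prod_congr rfl fun i _ => ?_
  rw [← permVal_fin τ (pairFst i), ← permVal_fin τ (pairSnd i)]
  simp [pairFst, pairSnd]

theorem IsMultiplicativeDistance.realMoment_eq_pfaffian_of_even (hΦ : IsMultiplicativeDistance Φ)
    (hP : IsCompleteMonicFamily P) (hs : (N : ℝ) < s.re) (hN : Even N) :
    realMoment Φ N s = pfaffian (skewMatrix Φ s P) := by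
  have hJ : 2 * ((N + 1) / 2) = N := by
    obtain ⟨k, rfl⟩ := hN; omega
  have h := hΦ.vandermondeProd_mul_pointMoment hP hs (r := 0) (by norm_num)
    (fun m z hm => hΦ.vandermondeProd_mul_pointMoment_zero hP
      (K := 2 * ((N + 1) / 2)) hJ m z hm) ((N + 1) / 2) 0 0
    (by omega)
  have h0 : pointMoment Φ s (2 * ((N + 1) / 2) + 0) 0 0 = pointMoment Φ s N 0 0 := by
    rw [add_zero, hJ]
  rw [h0] at h
  simp only [vandermondeProd, Finset.range_zero, Finset.prod_empty, one_mul] at h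
  rw [realMoment_eq_pointMoment 0, h, pfaffian, mixedSum]
  congr 1
  refine Finset.sum_congr rfl fun τ _ => ?_
  rw [pairFactor_zero_eq, pointFactor, Finset.range_zero, Finset.prod_empty, mul_one, mul_one]
  congr 1
  refine Finset.prod_congr rfl fun i _ => ?_
  -- For even `N` all indices are below `N`, so there is no border.
  rw [skewMatrix_apply_eq, if_neg (by omega), if_neg (by omega), sub_zero, add_zero]
  rfl

theorem prod_erase_eq_pairFactor {J : ℕ} (τ : Equiv.Perm (Fin (2 * J))) (c : Fin J) {j : ℕ}
    (hc : (c : ℕ) = j) (hj : J = j + 1) :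
    ∏ i ∈ Finset.univ.erase c, skewForm Φ s (extendFamily P (τ (pairFst i)))
      (extendFamily P (τ (pairSnd i))) = pairFactor Φ s P τ j 0 := by
  have h : Finset.range j = (Finset.univ.erase c).map Fin.valEmbedding := by
    ext i
    simp only [Finset.mem_range, Finset.mem_map, Finset.mem_erase, Finset.mem_univ, and_true,
      Fin.valEmbedding_apply]
    constructor
    · intro hi
      refine ⟨⟨i, by omega⟩, fun h => ?_, rfl⟩
      have := congrArg Fin.val h
      simp only at this
      omega
    · rintro ⟨k, hk, rfl⟩
      have h1 : (k : ℕ) ≠ c := fun h => hk (Fin.ext h)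
      have := k.2
      omega
  rw [pairFactor, h, Finset.prod_map]
  refine Finset.prod_congr rfl fun i _ => ?_
  rw [← permVal_fin τ (pairFst i), ← permVal_fin τ (pairSnd i)]
  simp [pairFst, pairSnd]

/-- The matrix is `u + A - Aᵀ`, where `A` holds the border integrals in column `N` and `u` vanishes
on row and column `N`, as the family is extended by zero. The induction yields only permutations
with the border in the last pair and with `N` in its second position; `sum_perm_bordered` shows that
the full Pfaffian sum is `2J` times this. -/
theorem IsMultiplicativeDistance.realMoment_eq_pfaffian_of_odd (hΦ : IsMultiplicativeDistance Φ)
    (hP : IsCompleteMonicFamily P) (hs : (N : ℝ) < s.re) (hN : Odd N) :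
    realMoment Φ N s = pfaffian (skewMatrix Φ s P) := by
  obtain ⟨j, hj⟩ := id hN
  have hJ : (N + 1) / 2 = j + 1 := by omega
  have h := hΦ.vandermondeProd_mul_pointMoment hP hs (r := 1) (by norm_num)
    (fun m z hm => hΦ.vandermondeProd_mul_pointMoment_one hP hs hN
      (K := 2 * ((N + 1) / 2)) (by omega) m z hm) j 0 0 (by omega)
  rw [← hj] at h
  simp only [vandermondeProd, Finset.range_zero, Finset.prod_empty, one_mul] at h
  rw [realMoment_eq_pointMoment 0, h, pfaffian, mixedSum]
  have hNlt : N < 2 * ((N + 1) / 2) := by omega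
  have hN0 : extendFamily P N = 0 := by simp [extendFamily]
  let u : Fin (2 * ((N + 1) / 2)) → Fin (2 * ((N + 1) / 2)) → ℂ := fun a b =>
    skewForm Φ s (extendFamily P a) (extendFamily P b)
  let A : Fin (2 * ((N + 1) / 2)) → Fin (2 * ((N + 1) / 2)) → ℂ := fun a b =>
    if (b : ℕ) = N then ∫ x : ℝ, borderIntegrand Φ s (extendFamily P a) x else 0
  have key := sum_perm_bordered u A ⟨N, hNlt⟩
    (fun k => ⟨by simp only [u, hN0, skewForm_zero_left],
      by simp only [u, hN0, skewForm_zero_right]⟩)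
    (fun a b hb => if_neg fun h => hb (Fin.ext h)) ⟨j, by omega⟩
  have hpf : ∑ τ : Equiv.Perm (Fin (2 * ((N + 1) / 2))), ((Equiv.Perm.sign τ : ℤ) : ℂ) *
      ∏ i : Fin ((N + 1) / 2), skewMatrix Φ s P (τ ⟨2 * (i : ℕ), by omega⟩)
        (τ ⟨2 * (i : ℕ) + 1, by omega⟩) =
      ∑ τ : Equiv.Perm (Fin (2 * ((N + 1) / 2))), ((Equiv.Perm.sign τ : ℤ) : ℂ) *
      ∏ i : Fin ((N + 1) / 2), (u (τ (pairFst i)) (τ (pairSnd i)) +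
        (A (τ (pairFst i)) (τ (pairSnd i)) - A (τ (pairSnd i)) (τ (pairFst i)))) := by
    refine Finset.sum_congr rfl fun τ _ => ?_
    congr 1
    exact Finset.prod_congr rfl fun i _ => skewMatrix_apply_eq P _ _
  rw [hpf, key]
  have hsum : ∑ τ : Equiv.Perm (Fin (2 * ((N + 1) / 2))), ((Equiv.Perm.sign τ : ℤ) : ℂ) *
      pointFactor P τ 0 0 * pairFactor Φ s P τ j 0 * borderFactor Φ s P τ =
      ∑ τ : Equiv.Perm (Fin (2 * ((N + 1) / 2))), ((Equiv.Perm.sign τ : ℤ) : ℂ) *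
      (A (τ (pairFst ⟨j, by omega⟩)) (τ (pairSnd ⟨j, by omega⟩)) *
        ∏ i ∈ Finset.univ.erase (⟨j, by omega⟩ : Fin ((N + 1) / 2)),
          u (τ (pairFst i)) (τ (pairSnd i))) := by
    refine Finset.sum_congr rfl fun τ _ => ?_
    have h1 := prod_erase_eq_pairFactor (Φ := Φ) (s := s) (P := P) τ ⟨j, by omega⟩ rfl hJ
    have h2 : permVal τ N = τ (pairSnd ⟨j, by omega⟩) := by
      rw [← permVal_fin]; congr 1
    have h3 : permVal τ (N - 1) = τ (pairFst ⟨j, by omega⟩) := by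
      rw [← permVal_fin]; congr 1; simp [pairFst]; omega
    simp only [u]
    rw [h1, borderFactor, h2, h3, pointFactor, Finset.range_zero, Finset.prod_empty, mul_one]
    simp only [A]
    split_ifs <;> ring
  rw [hsum, ← mul_assoc]
  congr 1
  -- With `J = j + 1`, the factor `2J` turns `1 / (2^J J!)` into the `1 / (2^j j!)` of the
  -- induction.
  rw [hJ, Nat.factorial_succ, pow_succ]
  have h3 : (j.factorial : ℂ) ≠ 0 := by exact_mod_cast j.factorial_ne_zero
  have h4 : ((j : ℂ) + 1) ≠ 0 := by exact_mod_cast j.succ_ne_zero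
  push_cast
  field_simp

end Conclusion

end

/-- The conclusion includes the absolute convergence of every integral that enters the formula, and
the antisymmetry of the matrix. -/
theorem theorem5 (Φ : ℂ[X] → ℝ) (hΦ : IsMultiplicativeDistance Φ) (N : ℕ) (s : ℂ)
    (hs : (N : ℝ) < s.re) (P : Fin N → ℂ[X]) (hP : IsCompleteMonicFamily P) :
    Integrable (momentIntegrand Φ N s) ∧
    (∀ j k, Integrable (realFormIntegrand Φ s (P j) (P k))) ∧
    (∀ j k, Integrable (complexFormIntegrand Φ s (P j) (P k))) ∧
    (∀ j, Integrable (borderIntegrand Φ s (P j))) ∧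
    (skewMatrix Φ s P).transpose = -skewMatrix Φ s P ∧
    realMoment Φ N s = pfaffian (skewMatrix Φ s P) := by
  have hdeg : ∀ j, ((P j).natDegree : ℝ) + 1 < s.re := fun j => by
    have h1 : ((P j).natDegree : ℝ) + 1 ≤ N := by
      rw [(hP j).2]; exact_mod_cast j.2
    linarith
  refine ⟨hΦ.integrable_momentIntegrand hs, fun j k => hΦ.integrable_realForm (hdeg j) (hdeg k),
    fun j k => hΦ.integrable_complexForm (hdeg j) (hdeg k), fun j => hΦ.integrable_border (hdeg j),
    skewMatrix_transpose P, ?_⟩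
  rcases N.even_or_odd with h | h
  · exact hΦ.realMoment_eq_pfaffian_of_even hP hs h
  · exact hΦ.realMoment_eq_pfaffian_of_odd hP hs h
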